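/- **Model.** $n\ge 1$ asynchronous anonymous sequential processes run the same code, and any of them may stop taking steps at any time. They access a shared base object by atomic operations. An execution (finite or infinite) is a sequence of steps; in each step one process invokes an operation, performs a local action or an operation on the base object, or returns a response. An execution is *linearizable* with respect to a sequential specification if all its terminated operations and some of its non-terminated ones (given suitable responses) can be listed in a sequence that respects the specification and in which an operation that terminates before another one is invoked comes first. An implementation is *linearizable* if all its executions are, and *non-blocking* if in every execution with infinitely many steps infinitely many operations terminate. A *weak set* over a set $V$ has operations $\mathrm{add}(v)$, $v\in V$, returning $ACK$, and $\mathrm{get}()$, returning the set of the arguments of all preceding $\mathrm{add}$ operations. A *snapshot object* with $n$ components holds an array $R[0],\dots,R[n-1]$ of subsets of $V$, initially all $\emptyset$; $\mathrm{update}(i,S)$ sets $R[i]$ to $S$, and $\mathrm{scan}()$ returns the array $R$. **Algorithm.** Every process keeps a local variable $View\subseteq V$, initially $\emptyset$, from one operation to the next. * $\mathrm{add}(v)$: $next:=0$; $Snap:=R.\mathrm{scan}()$; $View:=View\cup\bigcup_i Snap[i]\cup\{v\}$; while $\#\{r: v\in Snap[r]\}<n$ do [ $R.\mathrm{update}(next,View)$;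 $next:=(next+1)\bmod n$; $Snap:=R.\mathrm{scan}()$; $View:=View\cup\bigcup_i Snap[i]$ ]; return $ACK$. * $\mathrm{get}()$: $next:=0$; $Snap:=R.\mathrm{scan}()$; $View:=View\cup\bigcup_i Snap[i]$; while $\#\{r: View= Snap[r]\}<n$ do the same loop body; return $View$. **Linearization points.** Consider an execution of the algorithm in which scans and updates are atomic. For $S\subseteq V$ let $\tau_S$ be the first time at which $S\subseteq R[i]$ for all $i$ (undefined if there is none), and write $\tau_v=\tau_{\{v\}}$. The linearization point of an operation $op=\mathrm{add}(v)$ is $\tau_{op}=\max\{\tau_v,\mathrm{invoc}(op)\}$ if $\tau_v$ is defined, and that of an operation $op=\mathrm{get}()$ that terminates and returns $S$ is $\tau_{op}=\max\{\tau_S,\mathrm{invoc}(op)\}$ if $\tau_S$ is defined. Other operations have no linearization point. **Theorem.** Let $n\ge1$ and let $V$ be a set. 1. In every execution of the algorithm on an atomic snapshot object with $n$ components: every linearization point $\tau_{op}$ lies between the invocation of $op$ and its response (if there is one); every terminated operation has a linearization point; the operations that have a linearization point can be listed in the order of their points, $\mathrm{add}$ before $\mathrm{get}$ at equal points; and every such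 list satisfies the sequential specification of the weak set, with the responses of the execution, and is a linearization of the execution. 2. The algorithm on an atomic snapshot object with $n$ components is non-blocking. 3. Let $I$ be any anonymous implementation, by $n$ processes, of a snapshot object with $n$ components from $n$ atomic multi-writer/multi-reader registers (with contents in any set, initialized to a default value) that is linearizable and non-blocking. Then the algorithm with its scans and updates executed by the code of $I$ is a linearizable and non-blocking implementation, from the same $n$ registers, of a weak set over $V$. -/

import Mathlib

namespace AnonShm

/-! ### Sequential objects and anonymous algorithms -/

/-- A (deterministic) sequential specification of a shared object with operations `Op` and
responses `Res`: a state space, an initial state, and the effect and response of every operation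
in every state. -/
structure SeqSpec (Op Res : Type*) where
  /-- The states of the object. -/
  State : Type*
  /-- The initial state. -/
  init : State
  /-- New state and response. -/
  step : State → Op → State × Res

/-- What a running process does next: an atomic operation `b` on the base object, continuing
according to its response; a local step; or returning from the current high-level operation with
response `r` and persistent memory `m`. -/
inductive Action (Res BOp BRes Mem Run : Type*) where
  | call (b : BOp) (k : BRes → Run)
  | internal (x : Run)
  | ret (r : Res) (m : Mem)

/-- An anonymous algorithm that implements the operations `Op` (with responses `Res`) by means of
operations `BOp` (with responses `BRes`) on a base object. All processes run this same code, and
the code has no access to process names. `Mem` is the local memory that a process keeps between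
two operations, `Run` is its local state (memory and program counter) during an operation. -/
structure Algorithm (Op Res BOp BRes : Type*) where
  /-- Local memory of a process between operations. -/
  Mem : Type*
  /-- Local state of a process during an operation. -/
  Run : Type*
  /-- Initial local memory, the same for all processes. -/
  init : Mem
  /-- Beginning of an operation. -/
  start : Op → Mem → Run
  /-- The next action of a process during an operation. -/
  next : Run → Action Res BOp BRes Mem Run

/-- Composition: run `A`, replacing every operation on its base object by the code of `B`.
A running process either executes code of `A` (left summand, with the memory of `B` at rest), or
executes an operation of `B` (right summand, with the continuation of `A`). -/
def Algorithm.comp {Op Res BOp BRes COp CRes : Type*}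
    (A : Algorithm Op Res BOp BRes) (B : Algorithm BOp BRes COp CRes) :
    Algorithm Op Res COp CRes where
  Mem := A.Mem × B.Mem
  Run := (A.Run × B.Mem) ⊕ ((BRes → A.Run) × B.Run)
  init := (A.init, B.init)
  start o m := .inl (A.start o m.1, m.2)
  next
    | .inl (a, m) =>
      match A.next a with
      | .call b k => .internal (.inr (k, B.start b m))
      | .internal a' => .internal (.inl (a', m))
      | .ret r a' => .ret r (a', m)
    | .inr (k, b) =>
      match B.next b with
      | .call c k' => .call c (fun r => .inr (k, k' r))
      | .internal b' => .internal (.inr (k, b'))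
      | .ret r m => .internal (.inl (k r, m))

/-! ### Executions of `n` asynchronous processes -/

/-- An event: process `p` invokes operation `o`, takes a step inside an operation, or returns from
its current operation with response `r`. -/
inductive Event (n : ℕ) (Op Res : Type*) where
  | inv (p : Fin n) (o : Op)
  | int (p : Fin n)
  | res (p : Fin n) (r : Res)

section Executions

variable {Op Res BOp BRes : Type*}

/-- A global configuration: the state of the atomic base object, and for every process its memory
(if it is between operations) or its running state (if it is executing an operation). -/
structure Config (n : ℕ) (A : Algorithm Op Res BOp BRes) (β : SeqSpec BOp BRes) where
  /-- State of the base object. -/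
  base : β.State
  /-- Local states of the processes. -/
  proc : Fin n → A.Mem ⊕ A.Run

/-- One step of the system; the label `none` means that nothing happens. Operations on the base
object are atomic. -/
inductive Step (n : ℕ) (A : Algorithm Op Res BOp BRes) (β : SeqSpec BOp BRes) :
    Config n A β → Option (Event n Op Res) → Config n A β → Prop where
  | none (c : Config n A β) : Step n A β c none c
  | inv (c : Config n A β) (p : Fin n) (o : Op) (m : A.Mem) (h : c.proc p = .inl m) :
      Step n A β c (some (.inv p o)) ⟨c.base, Function.update c.proc p (.inr (A.start o m))⟩
  | call (c : Config n A β) (p : Fin n) (x : A.Run) (b : BOp) (k : BRes → A.Run)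
      (h : c.proc p = .inr x) (hx : A.next x = .call b k) :
      Step n A β c (some (.int p))
        ⟨(β.step c.base b).1, Function.update c.proc p (.inr (k (β.step c.base b).2))⟩
  | internal (c : Config n A β) (p : Fin n) (x y : A.Run)
      (h : c.proc p = .inr x) (hx : A.next x = .internal y) :
      Step n A β c (some (.int p)) ⟨c.base, Function.update c.proc p (.inr y)⟩
  | ret (c : Config n A β) (p : Fin n) (x : A.Run) (r : Res) (m : A.Mem)
      (h : c.proc p = .inr x) (hx : A.next x = .ret r m) :
      Step n A β c (some (.res p r)) ⟨c.base, Function.update c.proc p (.inl m)⟩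

/-- An execution of `n` processes running `A` on an atomic base object `β`. Step `t` leads from
`cfg t` to `cfg (t + 1)`. Which process moves, and which operations are invoked, is arbitrary; a
process may stop at any moment (crash). Finite executions are those with `ev t = none` for all
large `t`. -/
structure Execution (n : ℕ) (A : Algorithm Op Res BOp BRes) (β : SeqSpec BOp BRes) where
  /-- Configuration at time `t`. -/
  cfg : ℕ → Config n A β
  /-- Event of step `t`. -/
  ev : ℕ → Option (Event n Op Res)
  init_base : (cfg 0).base = β.init
  init_proc : ∀ p, (cfg 0).proc p = .inl A.init
  step : ∀ t, Step n A β (cfg t) (ev t) (cfg (t + 1))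

/-- The operation invoked at step `t` (operations are identified by the step of their invocation)
terminates at step `r` with response `y`. -/
def Returns {n : ℕ} (ev : ℕ → Option (Event n Op Res)) (t r : ℕ) (y : Res) : Prop :=
  ∃ p o, ev t = some (.inv p o) ∧ t < r ∧ ev r = some (.res p y) ∧
    ∀ s, t < s → s < r → ∀ y', ev s ≠ some (.res p y')

/-- `seq` lists (entries `none` are gaps) some operations of the history `ev`, and this sequential
history is a linearization of `ev` with respect to `σ`: every terminated operation occurs, no
operation occurs twice, an operation that terminates before another one is invoked precedes it, and
executing the operations one after the other according to `σ` produces the responses of `ev`. Of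
the operations that do not terminate some may be listed (they get the response that `σ` dictates)
and the others are dropped. -/
structure IsLinearization {n : ℕ} (σ : SeqSpec Op Res) (ev : ℕ → Option (Event n Op Res))
    (seq : ℕ → Option ℕ) : Prop where
  isOp : ∀ k t, seq k = some t → ∃ p o, ev t = some (.inv p o)
  inj : ∀ k l t, seq k = some t → seq l = some t → k = l
  complete : ∀ t r y, Returns ev t r y → ∃ k, seq k = some t
  realTime : ∀ k l t t' r y, seq k = some t → seq l = some t' → Returns ev t r y → r < t' → k < l
  legal : ∃ st : ℕ → σ.State, st 0 = σ.init ∧ ∀ k,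
    (seq k = none → st (k + 1) = st k) ∧
    ∀ t p o, seq k = some t → ev t = some (.inv p o) →
      st (k + 1) = (σ.step (st k) o).1 ∧
      ∀ r y, Returns ev t r y → y = (σ.step (st k) o).2

/-- `A`, run by `n` processes on the atomic base object `β`, is a linearizable (atomic)
implementation of an object with sequential specification `σ`. -/
def Linearizable (n : ℕ) (A : Algorithm Op Res BOp BRes) (β : SeqSpec BOp BRes)
    (σ : SeqSpec Op Res) : Prop :=
  ∀ E : Execution n A β, ∃ seq, IsLinearization σ E.ev seq

/-- `A`, run by `n` processes on the atomic base object `β`, is non-blocking: if the processes take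
infinitely many steps, then infinitely many operations terminate. -/
def NonBlocking (n : ℕ) (A : Algorithm Op Res BOp BRes) (β : SeqSpec BOp BRes) : Prop :=
  ∀ E : Execution n A β, (∃ᶠ t in Filter.atTop, E.ev t ≠ none) →
    ∃ᶠ t in Filter.atTop, ∃ p r, E.ev t = some (.res p r)

end Executions

/-! ### Registers, snapshot and weak set -/

/-- Operations on an array of `m` registers. -/
inductive RegOp (m : ℕ) (W : Type*) where
  | read (i : Fin m)
  | write (i : Fin m) (w : W)

/-- Responses of registers. -/
inductive RegRes (W : Type*) where
  | val (w : W)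
  | ack

/-- An array of `m` multi-writer/multi-reader registers, all initialized to `w₀`. -/
def registers (m : ℕ) {W : Type*} (w₀ : W) : SeqSpec (RegOp m W) (RegRes W) where
  State := Fin m → W
  init := fun _ => w₀
  step R o :=
    match o with
    | .read i => (R, .val (R i))
    | .write i w => (Function.update R i w, .ack)

/-- Operations of a snapshot object with `m` components, each holding a set of values. -/
inductive SnapOp (m : ℕ) (V : Type*) where
  | scan
  | update (i : Fin m) (S : Set V)

/-- Responses of a snapshot object. -/
inductive SnapRes (m : ℕ) (V : Type*) where
  | view (S : Fin m → Set V)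
  | ack

/-- The snapshot object: an array of `m` sets of values, initially all empty. -/
def snapshot (m : ℕ) (V : Type*) : SeqSpec (SnapOp m V) (SnapRes m V) where
  State := Fin m → Set V
  init := fun _ => ∅
  step R o :=
    match o with
    | .scan => (R, .view R)
    | .update i S => (Function.update R i S, .ack)

/-- Operations of a weak set. -/
inductive SetOp (V : Type*) where
  | add (v : V)
  | get

/-- Responses of a weak set. -/
inductive SetRes (V : Type*) where
  | ack
  | vals (S : Set V)

/-- The sequential specification of the weak set: `get` returns the set of all arguments of the
preceding `add` operations. -/
def weakSetSpec (V : Type*) : SeqSpec (SetOp V) (SetRes V) where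
  State := Set V
  init := ∅
  step S o :=
    match o with
    | .add v => (insert v S, .ack)
    | .get => (S, .vals S)

/-! ### The weak set algorithm -/

/-- Local state of a process during an operation of the weak set algorithm: it is about to execute
a scan, an update, or the return instruction. `view` and `next` are the local variables of the
algorithm. -/
inductive WSRun (n : ℕ) (V : Type*) where
  | addScan (v : V) (next : Fin n) (view : Set V)
  | addUpdate (v : V) (next : Fin n) (view : Set V)
  | addReturn (view : Set V)
  | getScan (next : Fin n) (view : Set V)
  | getUpdate (next : Fin n) (view : Set V)
  | getReturn (view : Set V)

open Classical in
/-- After a scan with result `snap` in `add v`, and the assignment to `view`: evaluate the loop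
condition. -/
noncomputable def addTest {n : ℕ} {V : Type*} (v : V) (next : Fin n) (view : Set V)
    (snap : Fin n → Set V) : WSRun n V :=
  if {r | v ∈ snap r}.ncard < n then .addUpdate v next view else .addReturn view

open Classical in
/-- After a scan with result `snap` in `get`, and the assignment to `view`: evaluate the loop
condition. -/
noncomputable def getTest {n : ℕ} {V : Type*} (next : Fin n) (view : Set V)
    (snap : Fin n → Set V) : WSRun n V :=
  if {r | view = snap r}.ncard < n then .getUpdate next view else .getReturn view

/-- The weak set algorithm, on a snapshot object with `n` components. The persistent memory of a
process is its variable `View`, initially empty.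

`add v`: `next := 0`; `Snap := scan`; `View := View ∪ vals Snap ∪ {v}`; while the number of `r` with
`v ∈ Snap[r]` is less than `n`: `update(next, View)`; `next := next + 1 mod n`; `Snap := scan`;
`View := View ∪ vals Snap`. Return `ACK`.

`get`: `next := 0`; `Snap := scan`; `View := View ∪ vals Snap`; while the number of `r` with
`View = Snap[r]` is less than `n`: the same loop body. Return `View`.

Addition in `Fin n` is modulo `n`. In the scans of the loop of `add v` the term `{v}` changes
nothing, since `v ∈ View` already. A snapshot object never answers a scan by `ack`, so that the
second case of the matches does not occur. -/
noncomputable def weakSet (n : ℕ) [NeZero n] (V : Type*) :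
    Algorithm (SetOp V) (SetRes V) (SnapOp n V) (SnapRes n V) where
  Mem := Set V
  Run := WSRun n V
  init := ∅
  start o view :=
    match o with
    | .add v => .addScan v 0 view
    | .get => .getScan 0 view
  next
    | .addScan v next view => .call .scan fun
        | .view snap => addTest v next (view ∪ (⋃ i, snap i) ∪ {v}) snap
        | .ack => .addScan v next view
    | .addUpdate v next view => .call (.update next view) fun _ => .addScan v (next + 1) view
    | .addReturn view => .ret .ack view
    | .getScan next view => .call .scan fun
        | .view snap => getTest next (view ∪ ⋃ i, snap i) snap
        | .ack => .getScan next view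
    | .getUpdate next view => .call (.update next view) fun _ => .getScan (next + 1) view
    | .getReturn view => .ret (.vals view) view

/-! ### Linearization points -/

section Points

variable {n : ℕ} [NeZero n] {V : Type*}

/-- `τ` is the first time at which the set `S` is contained in all components of the array. -/
def FirstFull (E : Execution n (weakSet n V) (snapshot n V)) (S : Set V) (τ : ℕ) : Prop :=
  IsLeast {s : ℕ | ∀ i : Fin n, S ⊆ (show Fin n → Set V from (E.cfg s).base) i} τ

/-- `τ` is the linearization point of the operation invoked at step `t`. For `add v` it is the
maximum of the invocation and the first time at which `v` belongs to all components (if there is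
such a time). For a `get` that returns `S` it is the maximum of the invocation and the first time
at which `S` is contained in all components. Other operations have no linearization point. -/
def LinPoint (E : Execution n (weakSet n V) (snapshot n V)) (t τ : ℕ) : Prop :=
  (∃ p v s, E.ev t = some (.inv p (.add v)) ∧ FirstFull E {v} s ∧ τ = max s t) ∨
  (∃ p r S s, E.ev t = some (.inv p .get) ∧ Returns E.ev t r (.vals S) ∧ FirstFull E S s ∧
    τ = max s t)

/-- `seq` is a sequential history given by the linearization points: it lists exactly the
operations that have a linearization point, each once, in the order of their points, where at equal
points `add` operations precede `get` operations. -/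
structure IsPointOrder (E : Execution n (weakSet n V) (snapshot n V)) (seq : ℕ → Option ℕ) :
    Prop where
  mem_iff : ∀ t, (∃ k, seq k = some t) ↔ ∃ τ, LinPoint E t τ
  inj : ∀ k l t, seq k = some t → seq l = some t → k = l
  sorted : ∀ k l t t' τ τ', k < l → seq k = some t → seq l = some t' →
    LinPoint E t τ → LinPoint E t' τ' →
    τ < τ' ∨ (τ = τ' ∧
      ((∃ p, E.ev t = some (.inv p .get)) → ∃ p, E.ev t' = some (.inv p .get)))

end Points

end AnonShm

namespace AnonShm

/-! ### Pending operations -/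

section Pending

variable {n : ℕ} {Op Res BOp BRes : Type*}

/-! Safety rests on a counting argument (`WSExec.exists_mem_of_le`): a value `v` that has once been
in all components never vanishes from the array. Count the components lacking `v` together with the
processes about to write a set lacking `v`. When `v` first fills the array, no component lacks it
and the last writer has no write pending, so the count is below `n`. While it is below `n`, some
component contains `v`, so every scan puts `v` into the scanner's view and no new bad write can be
prepared; executing a bad write trades it for at most one bad component. The count therefore stays
below `n`.

A `get` returning `S` saw all components equal to `S` at a time `u` no earlier than its point. If
the point of an `add v` is no later than that of the `get`, then `v` filled the array by time `u`,
is still in some component, and so lies in `S`. Conversely, each `v` in `S` is in the array at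
`τ_S`, hence comes from an `add` invoked earlier (`WSExec.subset_added`), whose point is at most
`τ_S`. This gives `IsPointOrder.isLinearization`.

For progress (`WSExec.false_of_nonterminating`), suppose that steps go on forever without further
responses. Invocations then stop as well, only finitely many values occur, and the growing views
stabilize. The processes that move infinitely often write all components, so eventually every
component holds the stable view of one of them. A process whose stable view is minimal contains
every component it scans, so by minimality all components equal its view, and its loop ends: a
contradiction.

The last claim follows from a simulation (`exists_atomic_execution`). Merge the steps of the
composed execution with the positions of a linearization of the inner history, and execute each base
operation atomically when its position is passed. Invocations and responses of the outer operations
are kept in order, so linearizations can be pulled back. If the inner code runs forever, its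
progress makes infinitely many base operations terminate, and each of them is a step of the
simulated execution. -/

/-- The operation `o` invoked by `p` at step `t` has not returned before step `T`. -/
def OpenAt (ev : ℕ → Option (Event n Op Res)) (p : Fin n) (o : Op) (t T : ℕ) : Prop :=
  ev t = some (.inv p o) ∧ t < T ∧ ∀ s, t < s → s < T → ∀ y, ev s ≠ some (.res p y)

theorem returns_iff {ev : ℕ → Option (Event n Op Res)} {t r : ℕ} {y : Res} :
    Returns ev t r y ↔ ∃ p o, OpenAt ev p o t r ∧ ev r = some (.res p y) := by
  constructor
  · rintro ⟨p, o, h1, h2, h3, h4⟩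
    exact ⟨p, o, ⟨h1, h2, h4⟩, h3⟩
  · rintro ⟨p, o, ⟨h1, h2, h4⟩, h3⟩
    exact ⟨p, o, h1, h2, h3, h4⟩

theorem OpenAt.succ {ev : ℕ → Option (Event n Op Res)} {p : Fin n} {o : Op} {t T : ℕ}
    (h : OpenAt ev p o t T) (hT : ∀ y, ev T ≠ some (.res p y)) : OpenAt ev p o t (T + 1) := by
  refine ⟨h.1, by have := h.2.1; omega, fun s hs hs' => ?_⟩
  rcases Nat.lt_succ_iff_lt_or_eq.1 hs' with h' | rfl
  · exact h.2.2 s hs h'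
  · exact hT

theorem OpenAt.of_inv {ev : ℕ → Option (Event n Op Res)} {p : Fin n} {o : Op} {t : ℕ}
    (h : ev t = some (.inv p o)) : OpenAt ev p o t (t + 1) :=
  ⟨h, by omega, fun s _ _ => by omega⟩

theorem OpenAt.mono {ev : ℕ → Option (Event n Op Res)} {p : Fin n} {o : Op} {t T T' : ℕ}
    (h : OpenAt ev p o t T) (h1 : t < T') (h2 : T' ≤ T) : OpenAt ev p o t T' :=
  ⟨h.1, h1, fun s hs hs' => h.2.2 s hs (by omega)⟩

theorem Returns.unique {ev : ℕ → Option (Event n Op Res)} {t r r' : ℕ} {y y' : Res}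
    (h : Returns ev t r y) (h' : Returns ev t r' y') : r = r' ∧ y = y' := by
  obtain ⟨p, o, h1, h2, h3, h4⟩ := h
  obtain ⟨p', o', h1', h2', h3', h4'⟩ := h'
  rw [h1] at h1'
  obtain ⟨rfl, rfl⟩ : p = p' ∧ o = o' := by simpa using h1'
  rcases lt_trichotomy r r' with h | rfl | h
  · exact absurd h3 (h4' r h2 h y)
  · rw [h3] at h3'
    simpa using h3'
  · exact absurd h3' (h4 r' h2' h y')

variable {A : Algorithm Op Res BOp BRes} {β : SeqSpec BOp BRes}

theorem Step.proc_cases {c c' : Config n A β} {e : Option (Event n Op Res)}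
    (h : Step n A β c e c') (p : Fin n) :
    (∃ o m, e = some (.inv p o) ∧ c.proc p = .inl m ∧ c'.proc p = .inr (A.start o m)) ∨
    (∃ x x', e = some (.int p) ∧ c.proc p = .inr x ∧ c'.proc p = .inr x') ∨
    (∃ y x m, e = some (.res p y) ∧ c.proc p = .inr x ∧ c'.proc p = .inl m) ∨
    (c'.proc p = c.proc p ∧ (∀ o, e ≠ some (.inv p o)) ∧ e ≠ some (.int p) ∧
      ∀ y, e ≠ some (.res p y)) := by
  cases h with
  | none => simp
  | inv q o m h =>
    by_cases hq : p = q
    · subst hq; left; exact ⟨o, m, rfl, h, by simp⟩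
    · right; right; right; simp [Function.update_of_ne hq, Ne.symm hq]
  | call q x b k h hx =>
    by_cases hq : p = q
    · subst hq; right; left; exact ⟨x, _, rfl, h, by simp; rfl⟩
    · right; right; right; simp [Function.update_of_ne hq, Ne.symm hq]
  | internal q x y h hx =>
    by_cases hq : p = q
    · subst hq; right; left; exact ⟨x, _, rfl, h, by simp; rfl⟩
    · right; right; right; simp [Function.update_of_ne hq, Ne.symm hq]
  | ret q x r m h hx =>
    by_cases hq : p = q
    · subst hq; right; right; left; exact ⟨r, x, m, rfl, h, by simp⟩
    · right; right; right; simp [Function.update_of_ne hq, Ne.symm hq]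

/-- Together with `exists_openAt`, this identifies running local states with pending operations, so
that facts about histories and facts about local states can be exchanged. -/
theorem OpenAt.running {E : Execution n A β} {p : Fin n} {o : Op} {t T : ℕ}
    (h : OpenAt E.ev p o t T) : ∃ x, (E.cfg T).proc p = .inr x := by
  induction T with
  | zero => exact absurd h.2.1 (by omega)
  | succ T ih =>
    rcases (E.step T).proc_cases p with ⟨_, _, _, _, h3⟩ | ⟨_, _, _, _, h3⟩ |
      ⟨y, _, _, h1, _, _⟩ | ⟨h1, h2, _, _⟩
    · exact ⟨_, h3⟩
    · exact ⟨_, h3⟩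
    · rcases Nat.lt_succ_iff_lt_or_eq.1 h.2.1 with h' | rfl
      · exact absurd h1 (h.2.2 T h' (by omega) y)
      · rw [h.1] at h1; simp at h1
    · rcases Nat.lt_succ_iff_lt_or_eq.1 h.2.1 with h' | rfl
      · rw [h1]; exact ih (h.mono h' (by omega))
      · exact absurd h.1 (h2 o)

theorem exists_openAt {E : Execution n A β} {p : Fin n} {T : ℕ} {x : A.Run}
    (h : (E.cfg T).proc p = .inr x) : ∃ o t, OpenAt E.ev p o t T := by
  induction T generalizing x with
  | zero => rw [E.init_proc] at h; simp at h
  | succ T ih =>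
    rcases (E.step T).proc_cases p with ⟨o, _, h1, _, h3⟩ | ⟨_, _, h1, h2, h3⟩ |
      ⟨y, _, _, h1, _, h3⟩ | ⟨h1, h2, _, h4⟩
    · exact ⟨o, T, .of_inv h1⟩
    · obtain ⟨o, t, ht⟩ := ih h2
      exact ⟨o, t, ht.succ (by simp [h1])⟩
    · rw [h3] at h; simp at h
    · obtain ⟨o, t, ht⟩ := ih (h1 ▸ h)
      exact ⟨o, t, ht.succ h4⟩

theorem Execution.idle_of_inv (E : Execution n A β) {p : Fin n} {o : Op} {t : ℕ}
    (h : E.ev t = some (.inv p o)) : ∃ m, (E.cfg t).proc p = .inl m := by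
  rcases (E.step t).proc_cases p with ⟨o, m, h1, h2, h3⟩ | ⟨_, _, h1, h2, h3⟩ |
      ⟨y, _, _, h1, _, h3⟩ | ⟨h1, h2, _, h4⟩
  · exact ⟨m, h2⟩
  · simp [h] at h1
  · simp [h] at h1
  · exact absurd h (h2 o)

theorem Execution.running_of_res (E : Execution n A β) {p : Fin n} {y : Res} {t : ℕ}
    (h : E.ev t = some (.res p y)) : ∃ x, (E.cfg t).proc p = .inr x := by
  rcases (E.step t).proc_cases p with ⟨o, m, h1, h2, h3⟩ | ⟨_, _, h1, h2, h3⟩ |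
      ⟨y, x, _, h1, h2, h3⟩ | ⟨h1, h2, _, h4⟩
  · simp [h] at h1
  · simp [h] at h1
  · exact ⟨x, h2⟩
  · exact absurd h (h4 y)

/-- The later of two invocations would need an idle process, while the earlier operation keeps it
running. -/
theorem OpenAt.unique {E : Execution n A β} {p : Fin n} {o o' : Op} {t t' T : ℕ}
    (h : OpenAt E.ev p o t T) (h' : OpenAt E.ev p o' t' T) : t = t' := by
  rcases lt_trichotomy t t' with hlt | rfl | hlt
  · obtain ⟨m, hm⟩ := E.idle_of_inv h'.1
    obtain ⟨x, hx⟩ := (h.mono hlt h'.2.1.le).running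
    rw [hm] at hx; simp at hx
  · rfl
  · obtain ⟨m, hm⟩ := E.idle_of_inv h.1
    obtain ⟨x, hx⟩ := (h'.mono hlt h.2.1.le).running
    rw [hm] at hx; simp at hx

theorem Execution.exists_returns (E : Execution n A β) {p : Fin n} {y : Res} {r : ℕ}
    (h : E.ev r = some (.res p y)) : ∃ t, Returns E.ev t r y := by
  obtain ⟨x, hx⟩ := E.running_of_res h
  obtain ⟨o, t, ht⟩ := exists_openAt hx
  exact ⟨t, returns_iff.2 ⟨p, o, ht, h⟩⟩

end Pending

/-! ### Stretching the time of a history -/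

section Stretch

variable {n : ℕ} {Op Res : Type*}

/-- `ev'` has the same invocations and responses as `ev`, in the same order, where step `T` of
`ev` corresponds to step `φ T` of `ev'`. -/
structure Stretch (ev ev' : ℕ → Option (Event n Op Res)) (φ : ℕ → ℕ) : Prop where
  strictMono : StrictMono φ
  inv_iff : ∀ T p o, ev T = some (.inv p o) ↔ ev' (φ T) = some (.inv p o)
  res_iff : ∀ T p y, ev T = some (.res p y) ↔ ev' (φ T) = some (.res p y)
  range_inv : ∀ s p o, ev' s = some (.inv p o) → ∃ T, φ T = s
  range_res : ∀ s p y, ev' s = some (.res p y) → ∃ T, φ T = s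

variable {ev ev' : ℕ → Option (Event n Op Res)} {φ : ℕ → ℕ}

theorem Stretch.returns (h : Stretch ev ev' φ) {t r : ℕ} {y : Res} (hr : Returns ev t r y) :
    Returns ev' (φ t) (φ r) y := by
  obtain ⟨p, o, h1, h2, h3, h4⟩ := hr
  refine ⟨p, o, (h.inv_iff _ _ _).1 h1, h.strictMono h2, (h.res_iff _ _ _).1 h3, ?_⟩
  intro s hs hs' y' hy
  obtain ⟨T, rfl⟩ := h.range_res _ _ _ hy
  exact h4 T (h.strictMono.lt_iff_lt.1 hs) (h.strictMono.lt_iff_lt.1 hs') y'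
    ((h.res_iff _ _ _).2 hy)

/-- All invocations of `ev'` lie in the range of `φ`, so renaming the listed operations by the left
inverse of `φ` loses none of them; real-time order and responses transfer because `φ` is strictly
monotone. -/
theorem Stretch.exists_linearization (h : Stretch ev ev' φ) {σ : SeqSpec Op Res}
    {seq' : ℕ → Option ℕ} (hs : IsLinearization σ ev' seq') :
    ∃ seq, IsLinearization σ ev seq := by
  have hinv : ∀ t, Function.invFun φ (φ t) = t :=
    Function.leftInverse_invFun h.strictMono.injective
  have key : ∀ k t, (seq' k).map (Function.invFun φ) = some t ↔ seq' k = some (φ t) := by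
    intro k t
    constructor
    · intro hk
      obtain ⟨s, hs1, rfl⟩ := Option.map_eq_some_iff.1 hk
      obtain ⟨p, o, ho⟩ := hs.isOp k s hs1
      obtain ⟨T, rfl⟩ := h.range_inv _ _ _ ho
      rw [hinv, hs1]
    · intro hk
      simp [hk, hinv]
  refine ⟨fun k => (seq' k).map (Function.invFun φ), ?_, ?_, ?_, ?_, ?_⟩
  · intro k t hk
    obtain ⟨p, o, ho⟩ := hs.isOp k _ ((key k t).1 hk)
    exact ⟨p, o, (h.inv_iff _ _ _).2 ho⟩
  · intro k l t hk hl
    exact hs.inj k l _ ((key k t).1 hk) ((key l t).1 hl)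
  · intro t r y hr
    obtain ⟨k, hk⟩ := hs.complete _ _ _ (h.returns hr)
    exact ⟨k, (key k t).2 hk⟩
  · intro k l t t' r y hk hl hr hlt
    exact hs.realTime k l _ _ _ y ((key k t).1 hk) ((key l t').1 hl) (h.returns hr)
      (h.strictMono hlt)
  · obtain ⟨st, h0, hst⟩ := hs.legal
    refine ⟨st, h0, fun k => ⟨fun hk => (hst k).1 (Option.map_eq_none_iff.1 hk), ?_⟩⟩
    intro t p o hk ho
    obtain ⟨h1, h2⟩ := (hst k).2 _ p o ((key k t).1 hk) ((h.inv_iff _ _ _).1 ho)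
    exact ⟨h1, fun r y hr => h2 _ _ (h.returns hr)⟩

end Stretch

/-! ### Merging a history with a linearization of it -/

section Merge

/-- Some operation listed at position `K` or later, and all operations listed before it, have been
invoked before step `T`. -/
def Ready (seq : ℕ → Option ℕ) (x : ℕ × ℕ) : Prop :=
  ∃ k, x.2 ≤ k ∧ seq k ≠ none ∧ ∀ j, j ≤ k → ∀ t, seq j = some t → t < x.1

open Classical in
/-- The merging of the steps of a history (first component) and the positions of a linearization
(second component): a position is passed as soon as possible. -/
noncomputable def mergePath (seq : ℕ → Option ℕ) : ℕ → ℕ × ℕ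
  | 0 => (0, 0)
  | s + 1 =>
    if Ready seq (mergePath seq s) then ((mergePath seq s).1, (mergePath seq s).2 + 1)
    else ((mergePath seq s).1 + 1, (mergePath seq s).2)

variable {seq : ℕ → Option ℕ}

theorem mergePath_succ_of_ready {s : ℕ} (h : Ready seq (mergePath seq s)) :
    mergePath seq (s + 1) = ((mergePath seq s).1, (mergePath seq s).2 + 1) := by
  rw [mergePath, if_pos h]

theorem mergePath_succ_of_not_ready {s : ℕ} (h : ¬ Ready seq (mergePath seq s)) :
    mergePath seq (s + 1) = ((mergePath seq s).1 + 1, (mergePath seq s).2) := by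
  rw [mergePath, if_neg h]

theorem mergePath_monotone : Monotone (mergePath seq) := by
  refine monotone_nat_of_le_succ fun s => ?_
  by_cases h : Ready seq (mergePath seq s)
  · rw [mergePath_succ_of_ready h]; exact ⟨le_rfl, by simp⟩
  · rw [mergePath_succ_of_not_ready h]; exact ⟨by simp, le_rfl⟩

/-- No operation takes effect before its invocation: `Ready` bounds all operations up to a witness
`k` that is at least the position being passed. -/
theorem mergePath_lt (s : ℕ) {j t : ℕ} (hj : j < (mergePath seq s).2) (ht : seq j = some t) :
    t < (mergePath seq s).1 := by
  induction s with
  | zero => simp [mergePath] at hj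
  | succ s ih =>
    by_cases h : Ready seq (mergePath seq s)
    · rw [mergePath_succ_of_ready h] at hj ⊢
      obtain ⟨k, hk, -, hk'⟩ := h
      exact hk' j (by simp at hj; omega) t ht
    · rw [mergePath_succ_of_not_ready h] at hj ⊢
      have := ih hj
      simp; omega

/-- Only finitely many listed operations were invoked before `T`. Since `Ready` asks for a nonempty
position ahead, an infinite tail of gaps cannot hold up the merging. -/
theorem exists_not_ready (hinj : ∀ k l t, seq k = some t → seq l = some t → k = l) (T : ℕ) :
    ∃ B, ∀ K, B ≤ K → ¬ Ready seq (T, K) := by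
  have hfin : {k | ∃ t, t < T ∧ seq k = some t}.Finite := by
    refine Set.Finite.of_finite_image (f := fun k => (seq k).getD 0)
      ((Set.finite_Iio T).subset ?_) ?_
    · rintro _ ⟨k, ⟨t, ht, hk⟩, rfl⟩
      simpa [hk] using ht
    · rintro k ⟨t, ht, hk⟩ l ⟨t', ht', hl⟩ h
      simp only [hk, hl, Option.getD_some] at h
      subst h
      exact hinj k l t hk hl
  obtain ⟨B, hB⟩ := hfin.bddAbove
  refine ⟨B + 1, fun K hK => ?_⟩
  rintro ⟨k, hk, hne, hall⟩
  obtain ⟨t, ht⟩ := Option.ne_none_iff_exists'.1 hne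
  have := hB (show k ∈ _ from ⟨t, hall k le_rfl t ht, ht⟩)
  simp at hk; omega

theorem exists_mergePath_not_ready
    (hinj : ∀ k l t, seq k = some t → seq l = some t → k = l) (s : ℕ) :
    ∃ s', (mergePath seq s').1 = (mergePath seq s).1 ∧ ¬ Ready seq (mergePath seq s') := by
  by_contra! hcon
  have h : ∀ m, mergePath seq (s + m) = ((mergePath seq s).1, (mergePath seq s).2 + m) := by
    intro m
    induction m with
    | zero => simp
    | succ m ih =>
      rw [← add_assoc, mergePath_succ_of_ready (hcon _ (by rw [ih])), ih]; rfl
  obtain ⟨B, hB⟩ := exists_not_ready hinj (mergePath seq s).1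
  refine hB ((mergePath seq s).2 + B) (by omega) ?_
  rw [← h]
  exact hcon _ (by rw [h])

theorem exists_mergePath_advance
    (hinj : ∀ k l t, seq k = some t → seq l = some t → k = l) (T : ℕ) :
    ∃ s, (mergePath seq s).1 = T ∧ ¬ Ready seq (mergePath seq s) := by
  induction T with
  | zero => exact exists_mergePath_not_ready hinj 0
  | succ T ih =>
    obtain ⟨s, hs, hr⟩ := ih
    obtain ⟨s', hs', hr'⟩ := exists_mergePath_not_ready hinj (s + 1)
    rw [mergePath_succ_of_not_ready hr] at hs'
    exact ⟨s', by rw [hs', hs], hr'⟩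

/-- Each history step is taken at exactly one index of the path, the one that is not ready; this
makes the time change `φ` below well defined and strictly monotone. -/
theorem mergePath_le_of_lt {s s' : ℕ} (h : ¬ Ready seq (mergePath seq s)) (hlt : s < s') :
    (mergePath seq s).1 < (mergePath seq s').1 := by
  have := (mergePath_monotone (seq := seq) (show s + 1 ≤ s' from hlt)).1
  rw [mergePath_succ_of_not_ready h] at this
  exact this

/-- No operation takes effect after its response. If its position `j` were still ahead when step `r`
is about to be taken, then `j` would witness `Ready`: by real-time order nothing invoked after `r`
is listed before `j`. -/
theorem mergePath_complete {n : ℕ} {Op Res : Type*} {σ : SeqSpec Op Res}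
    {ev : ℕ → Option (Event n Op Res)} (hs : IsLinearization σ ev seq)
    (s : ℕ) {t r : ℕ} {y : Res} (hr : Returns ev t r y)
    (hlt : r < (mergePath seq s).1 ∨ r = (mergePath seq s).1 ∧ ¬ Ready seq (mergePath seq s)) :
    ∃ j, j < (mergePath seq s).2 ∧ seq j = some t := by
  obtain ⟨j, hj⟩ := hs.complete t r y hr
  refine ⟨j, ?_, hj⟩
  have main : ∀ s, r = (mergePath seq s).1 → ¬ Ready seq (mergePath seq s) →
      j < (mergePath seq s).2 := by
    intro s h1 h2
    by_contra hle
    refine h2 ⟨j, by omega, by simp [hj], fun i hi u hu => ?_⟩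
    by_contra hu'
    rcases (show r ≤ u by omega).eq_or_lt with rfl | hlt
    · obtain ⟨p, o, ho⟩ := hs.isOp i _ hu
      obtain ⟨p', o', -, -, h3, -⟩ := hr
      rw [ho] at h3; simp at h3
    · have := hs.realTime j i t u r y hj hu hr hlt
      omega
  -- For indices at which the history has already moved past `r`, return to the index where step `r`
  -- was taken and use monotonicity.
  obtain ⟨s', h1, h2⟩ := exists_mergePath_advance hs.inj r
  have h3 := main s' h1.symm h2
  rcases hlt with hlt | ⟨h, h'⟩
  · have : s' ≤ s := by
      by_contra hcon
      have := (mergePath_monotone (seq := seq) (show s ≤ s' by omega)).1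
      omega
    exact h3.trans_le (mergePath_monotone this).2
  · exact main s h h'

end Merge

/-! ### Composition with a linearizable implementation of the base object -/

section Composition

variable {n : ℕ} {Op Res BOp BRes COp CRes : Type*}

/-- Local states of a process that runs `A.comp B`. -/
abbrev CompProc (A : Algorithm Op Res BOp BRes) (B : Algorithm BOp BRes COp CRes) :=
  (A.Mem × B.Mem) ⊕ ((A.Run × B.Mem) ⊕ ((BRes → A.Run) × B.Run))

/-- The local state of the implementation `B` of the base object. -/
def innerProc {A : Algorithm Op Res BOp BRes} {B : Algorithm BOp BRes COp CRes} :
    CompProc A B → B.Mem ⊕ B.Run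
  | .inl m => .inl m.2
  | .inr (.inl x) => .inl x.2
  | .inr (.inr x) => .inr x.2

/-- A step of `A.comp B`, with its event and the event that it represents for `B`. -/
inductive CompStep (A : Algorithm Op Res BOp BRes) (B : Algorithm BOp BRes COp CRes)
    (β : SeqSpec COp CRes) (s : β.State) (P : Fin n → CompProc A B) :
    Option (Event n Op Res) → Option (Event n BOp BRes) → β.State → (Fin n → CompProc A B) → Prop
    where
  | none : CompStep A B β s P none none s P
  | outerInv (p : Fin n) (o : Op) (a : A.Mem) (m : B.Mem) (h : P p = .inl (a, m)) :
      CompStep A B β s P (some (.inv p o)) .none s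
        (Function.update P p (.inr (.inl (A.start o a, m))))
  | outerInternal (p : Fin n) (a a' : A.Run) (m : B.Mem) (h : P p = .inr (.inl (a, m)))
      (hx : A.next a = .internal a') :
      CompStep A B β s P (some (.int p)) .none s (Function.update P p (.inr (.inl (a', m))))
  | outerRet (p : Fin n) (a : A.Run) (m : B.Mem) (r : Res) (a' : A.Mem)
      (h : P p = .inr (.inl (a, m))) (hx : A.next a = .ret r a') :
      CompStep A B β s P (some (.res p r)) .none s (Function.update P p (.inl (a', m)))
  | innerInv (p : Fin n) (a : A.Run) (m : B.Mem) (b : BOp) (k : BRes → A.Run)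
      (h : P p = .inr (.inl (a, m))) (hx : A.next a = .call b k) :
      CompStep A B β s P (some (.int p)) (some (.inv p b)) s
        (Function.update P p (.inr (.inr (k, B.start b m))))
  | innerCall (p : Fin n) (k : BRes → A.Run) (x : B.Run) (c : COp) (k' : CRes → B.Run)
      (h : P p = .inr (.inr (k, x))) (hx : B.next x = .call c k') :
      CompStep A B β s P (some (.int p)) (some (.int p)) (β.step s c).1
        (Function.update P p (.inr (.inr (k, k' (β.step s c).2))))
  | innerInternal (p : Fin n) (k : BRes → A.Run) (x y : B.Run)
      (h : P p = .inr (.inr (k, x))) (hx : B.next x = .internal y) :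
      CompStep A B β s P (some (.int p)) (some (.int p)) s
        (Function.update P p (.inr (.inr (k, y))))
  | innerRet (p : Fin n) (k : BRes → A.Run) (x : B.Run) (r : BRes) (m : B.Mem)
      (h : P p = .inr (.inr (k, x))) (hx : B.next x = .ret r m) :
      CompStep A B β s P (some (.int p)) (some (.res p r)) s
        (Function.update P p (.inr (.inl (k r, m))))

variable {A : Algorithm Op Res BOp BRes} {B : Algorithm BOp BRes COp CRes}
  {β : SeqSpec COp CRes} {σ : SeqSpec BOp BRes}

theorem Step.exists_compStep {c c' : Config n (A.comp B) β} {e : Option (Event n Op Res)}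
    (h : Step n (A.comp B) β c e c') :
    ∃ e', CompStep A B β c.base c.proc e e' c'.base c'.proc := by
  cases h with
  | none => exact ⟨_, .none⟩
  | inv p o m h => exact ⟨_, .outerInv p o m.1 m.2 h⟩
  | call p x b k h hx =>
    rcases x with ⟨a, m⟩ | ⟨k', x⟩
    · simp only [Algorithm.comp] at hx
      cases ha : A.next a <;> simp [ha] at hx
    · simp only [Algorithm.comp] at hx
      cases hb : B.next x with
      | call c k'' =>
        rw [hb] at hx
        cases hx
        exact ⟨_, .innerCall p k' x _ k'' h hb⟩
      | internal y => simp [hb] at hx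
      | ret r m => simp [hb] at hx
  | internal p x y h hx =>
    rcases x with ⟨a, m⟩ | ⟨k', x⟩
    · simp only [Algorithm.comp] at hx
      cases ha : A.next a with
      | call b k =>
        rw [ha] at hx
        cases hx
        exact ⟨_, .innerInv p a m b k h ha⟩
      | internal a' =>
        rw [ha] at hx
        cases hx
        exact ⟨_, .outerInternal p a a' m h ha⟩
      | ret r a' => simp [ha] at hx
    · simp only [Algorithm.comp] at hx
      cases hb : B.next x with
      | call c k'' => simp [hb] at hx
      | internal y' =>
        rw [hb] at hx
        cases hx
        exact ⟨_, .innerInternal p k' x y' h hb⟩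
      | ret r m =>
        rw [hb] at hx
        cases hx
        exact ⟨_, .innerRet p k' x r m h hb⟩
  | ret p x r m h hx =>
    rcases x with ⟨a, m'⟩ | ⟨k', x⟩
    · simp only [Algorithm.comp] at hx
      cases ha : A.next a with
      | call b k => simp [ha] at hx
      | internal a' => simp [ha] at hx
      | ret r' a' =>
        rw [ha] at hx
        cases hx
        exact ⟨_, .outerRet p a m' _ a' h ha⟩
    · simp only [Algorithm.comp] at hx
      cases hb : B.next x <;> simp [hb] at hx

theorem innerProc_update (P : Fin n → CompProc A B) (p : Fin n) (x : CompProc A B) :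
    (fun q => innerProc (Function.update P p x q)) =
      Function.update (fun q => innerProc (P q)) p (innerProc x) := by
  ext1 q
  by_cases h : q = p
  · subst h; simp
  · simp [h]

theorem innerProc_update_eq {P : Fin n → CompProc A B} {p : Fin n} {x : CompProc A B}
    (h : innerProc (P p) = innerProc x) :
    (fun q => innerProc (Function.update P p x q)) = fun q => innerProc (P q) := by
  rw [innerProc_update, ← h, Function.update_eq_self]

/-- Steps of the outer code leave the state of `B` untouched, so they become idle steps of the inner
execution. -/
theorem CompStep.inner {s s' : β.State} {P P' : Fin n → CompProc A B}
    {e : Option (Event n Op Res)} {e' : Option (Event n BOp BRes)}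
    (h : CompStep A B β s P e e' s' P') :
    Step n B β ⟨s, fun p => innerProc (P p)⟩ e' ⟨s', fun p => innerProc (P' p)⟩ := by
  cases h with
  | none => exact .none _
  | outerInv p o a m h => rw [innerProc_update_eq (by rw [h]; rfl)]; exact .none _
  | outerInternal p a a' m h hx => rw [innerProc_update_eq (by rw [h]; rfl)]; exact .none _
  | outerRet p a m r a' h hx => rw [innerProc_update_eq (by rw [h]; rfl)]; exact .none _
  | innerInv p a m b k h hx =>
    rw [innerProc_update]
    exact .inv ⟨s, fun p => innerProc (P p)⟩ p b m (by simp [h, innerProc])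
  | innerCall p k x c k' h hx =>
    rw [innerProc_update]
    exact .call ⟨s, fun p => innerProc (P p)⟩ p x c k' (by simp [h, innerProc]) hx
  | innerInternal p k x y h hx =>
    rw [innerProc_update]
    exact .internal ⟨s, fun p => innerProc (P p)⟩ p x y (by simp [h, innerProc]) hx
  | innerRet p k x r m h hx =>
    rw [innerProc_update]
    exact .ret ⟨s, fun p => innerProc (P p)⟩ p x r m (by simp [h, innerProc]) hx

/-- The execution of the implementation of the base object inside an execution of `A.comp B`. -/
theorem Execution.exists_inner (E : Execution n (A.comp B) β) :
    ∃ F : Execution n B β, ∀ t, CompStep A B β (E.cfg t).base (E.cfg t).proc (E.ev t) (F.ev t)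
      (E.cfg (t + 1)).base (E.cfg (t + 1)).proc ∧
      (F.cfg t).proc = fun p => innerProc (A := A) (B := B) ((E.cfg t).proc p) := by
  choose e he using fun t => (E.step t).exists_compStep
  exact ⟨⟨fun t => ⟨(E.cfg t).base, fun p => innerProc (A := A) (B := B) ((E.cfg t).proc p)⟩, e,
    E.init_base, fun p => by simp only [E.init_proc]; rfl, fun t => (he t).inner⟩,
    fun t => ⟨he t, rfl⟩⟩

/-! ### The simulation of the composed system by the atomic one -/

/-- Relation between the local state of process `p` of `A.comp B` before step `x.1` and its state
when it runs `A` on an atomic base object on which the operations at the positions below `x.2` of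
the linearization `seq` of `ev` have been executed. -/
inductive SimProc (A : Algorithm Op Res BOp BRes) (B : Algorithm BOp BRes COp CRes)
    (σ : SeqSpec BOp BRes) (ev : ℕ → Option (Event n BOp BRes)) (seq : ℕ → Option ℕ)
    (st : ℕ → σ.State) (x : ℕ × ℕ) (p : Fin n) : CompProc A B → A.Mem ⊕ A.Run → Prop
  | idle (a : A.Mem) (m : B.Mem) : SimProc A B σ ev seq st x p (.inl (a, m)) (.inl a)
  | outer (a : A.Run) (m : B.Mem) : SimProc A B σ ev seq st x p (.inr (.inl (a, m))) (.inr a)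
  | pending (a : A.Run) (k : BRes → A.Run) (y : B.Run) (b : BOp) (t : ℕ)
      (ho : OpenAt ev p b t x.1) (hn : ∀ j, j < x.2 → seq j ≠ some t) (ha : A.next a = .call b k) :
      SimProc A B σ ev seq st x p (.inr (.inr (k, y))) (.inr a)
  | done (k : BRes → A.Run) (y : B.Run) (b : BOp) (t j : ℕ)
      (ho : OpenAt ev p b t x.1) (hj : j < x.2) (hs : seq j = some t) :
      SimProc A B σ ev seq st x p (.inr (.inr (k, y))) (.inr (k (σ.step (st j) b).2))

theorem SimProc.advance {ev : ℕ → Option (Event n BOp BRes)} {seq : ℕ → Option ℕ}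
    {st : ℕ → σ.State} {T K : ℕ} {p : Fin n} {c : CompProc A B} {d : A.Mem ⊕ A.Run}
    (h : SimProc A B σ ev seq st (T, K) p c d) (hT : ∀ y, ev T ≠ some (.res p y)) :
    SimProc A B σ ev seq st (T + 1, K) p c d := by
  cases h with
  | idle a m => exact .idle a m
  | outer a m => exact .outer a m
  | pending a k y b t ho hn ha => exact .pending a k y b t (ho.succ hT) hn ha
  | done k y b t j ho hj hs => exact .done k y b t j (ho.succ hT) hj hs

theorem SimProc.pass {ev : ℕ → Option (Event n BOp BRes)} {seq : ℕ → Option ℕ}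
    {st : ℕ → σ.State} {T K : ℕ} {p : Fin n} {c : CompProc A B} {d : A.Mem ⊕ A.Run}
    (h : SimProc A B σ ev seq st (T, K) p c d)
    (hT : ∀ b t, OpenAt ev p b t T → seq K ≠ some t) :
    SimProc A B σ ev seq st (T, K + 1) p c d := by
  cases h with
  | idle a m => exact .idle a m
  | outer a m => exact .outer a m
  | pending a k y b t ho hn ha =>
    refine .pending a k y b t ho (fun j hj => ?_) ha
    rcases Nat.lt_succ_iff_lt_or_eq.1 hj with h | rfl
    · exact hn j h
    · exact hT b t ho
  | done k y b t j ho hj hs => exact .done k y b t j ho (Nat.lt_succ_of_lt hj) hs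

/-- Relation between a configuration of `A.comp B` and a configuration of `A` on an atomic base
object, see `SimProc`. -/
def Sim (σ : SeqSpec BOp BRes) (ev : ℕ → Option (Event n BOp BRes)) (seq : ℕ → Option ℕ)
    (st : ℕ → σ.State) (x : ℕ × ℕ) (P : Fin n → CompProc A B) (d : Config n A σ) : Prop :=
  d.base = st x.2 ∧ ∀ p, SimProc A B σ ev seq st x p (P p) (d.proc p)

section Simulation

variable {E : Execution n (A.comp B) β} {F : Execution n B β} {seq : ℕ → Option ℕ}
  {st : ℕ → σ.State}

/-- Taking a step of the history copies an outer step and ignores an inner one. The critical case is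
an inner response: the operation must have been executed already, and with the same response. -/
theorem Sim.exists_advance
    (hF : ∀ t, CompStep A B β (E.cfg t).base (E.cfg t).proc (E.ev t) (F.ev t)
      (E.cfg (t + 1)).base (E.cfg (t + 1)).proc)
    (hs : IsLinearization σ F.ev seq)
    (hst : ∀ k t p b, seq k = some t → F.ev t = some (.inv p b) →
      ∀ r y, Returns F.ev t r y → y = (σ.step (st k) b).2)
    {s : ℕ} (hr : ¬ Ready seq (mergePath seq s)) {d : Config n A σ}
    (hd : Sim (A := A) (B := B) σ F.ev seq st (mergePath seq s)
      (E.cfg (mergePath seq s).1).proc d) :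
    ∃ e d', Step n A σ d e d' ∧
      Sim (A := A) (B := B) σ F.ev seq st (mergePath seq (s + 1))
        (E.cfg (mergePath seq (s + 1)).1).proc d' ∧
      (e = E.ev (mergePath seq s).1 ∨ e = none ∧ ∃ p, E.ev (mergePath seq s).1 = some (.int p)) ∧
      (F.ev (mergePath seq s).1 = none → e = E.ev (mergePath seq s).1) := by
  have hlt : ∀ j t, j < (mergePath seq s).2 → seq j = some t → t < (mergePath seq s).1 :=
    fun j t => mergePath_lt s
  have hcomp : ∀ t y, Returns F.ev t (mergePath seq s).1 y →
      ∃ j, j < (mergePath seq s).2 ∧ seq j = some t :=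
    fun t y h => mergePath_complete hs s h (.inr ⟨rfl, hr⟩)
  rw [mergePath_succ_of_not_ready hr]
  generalize mergePath seq s = x at *
  obtain ⟨T, K⟩ := x
  simp only at *
  obtain ⟨hb, hp⟩ := hd
  simp only at hb
  have hstep := hF T
  revert hstep
  generalize hc : E.cfg (T + 1) = c'
  obtain ⟨s', P'⟩ := c'
  obtain ⟨P, hP⟩ : ∃ P : Fin n → CompProc A B, (E.cfg T).proc = P := ⟨_, rfl⟩
  replace hp : ∀ p, SimProc A B σ F.ev seq st (T, K) p (P p) (d.proc p) := hP ▸ hp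
  rw [hP]
  generalize (E.cfg T).base = s0
  generalize hEv : E.ev T = e
  generalize hFv : F.ev T = e'
  intro hstep
  simp only at hstep
  -- processes that do not move
  have stay : ∀ (p : Fin n) (x : CompProc A B) (z : A.Mem ⊕ A.Run),
      (∀ q, q ≠ p → ∀ y, F.ev T ≠ some (.res q y)) →
      SimProc A B σ F.ev seq st (T + 1, K) p x z →
      ∀ q, SimProc A B σ F.ev seq st (T + 1, K) q (Function.update P p x q)
        (Function.update d.proc p z q) := by
    intro p x z hne hx q
    by_cases hq : q = p
    · subst hq; simpa using hx
    · rw [Function.update_of_ne hq, Function.update_of_ne hq]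
      exact (hp q).advance (hne q hq)
  have stay' : ∀ (p : Fin n) (x : CompProc A B),
      (∀ q, q ≠ p → ∀ y, F.ev T ≠ some (.res q y)) →
      SimProc A B σ F.ev seq st (T + 1, K) p x (d.proc p) →
      ∀ q, SimProc A B σ F.ev seq st (T + 1, K) q (Function.update P p x q) (d.proc q) := by
    intro p x hne hx q
    have := stay p x (d.proc p) hne hx q
    rwa [Function.update_eq_self] at this
  cases hstep with
  | none =>
    exact ⟨none, d, .none d, ⟨hb, fun p => (hp p).advance (by simp [hFv])⟩, .inl rfl, fun _ => rfl⟩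
  | outerInv p o a m h =>
    have h1 := hp p
    rw [h] at h1
    generalize hz : d.proc p = z at h1
    cases h1
    exact ⟨_, _, .inv d p o a hz, ⟨hb, stay p _ _ (by simp [hFv]) (.outer _ _)⟩, .inl rfl,
      fun _ => rfl⟩
  | outerInternal p a a' m h hx =>
    have h1 := hp p
    rw [h] at h1
    generalize hz : d.proc p = z at h1
    cases h1
    exact ⟨_, _, .internal d p a a' hz hx, ⟨hb, stay p _ _ (by simp [hFv]) (.outer _ _)⟩, .inl rfl,
      fun _ => rfl⟩
  | outerRet p a m r a' h hx =>
    have h1 := hp p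
    rw [h] at h1
    generalize hz : d.proc p = z at h1
    cases h1
    exact ⟨_, _, .ret d p a r a' hz hx, ⟨hb, stay p _ _ (by simp [hFv]) (.idle _ _)⟩, .inl rfl,
      fun _ => rfl⟩
  | innerInv p a m b k h hx =>
    have h1 := hp p
    rw [h] at h1
    generalize hz : d.proc p = z at h1
    cases h1
    refine ⟨none, d, .none d, ⟨hb, stay' p _ (by simp [hFv]) ?_⟩, .inr ⟨rfl, p, rfl⟩, by simp⟩
    rw [hz]
    -- Positions already passed list operations invoked before `T`, so the operation invoked at `T`
    -- is not among them.
    exact .pending a k _ b T (.of_inv hFv) (fun j hj hjT => lt_irrefl _ (hlt j T hj hjT)) hx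
  | innerCall p k x c k' h hx =>
    have h1 := hp p
    rw [h] at h1
    refine ⟨none, d, .none d, ⟨hb, stay' p _ (by simp [hFv]) ?_⟩, .inr ⟨rfl, p, rfl⟩, by simp⟩
    generalize hz : d.proc p = z at h1 ⊢
    cases h1 with
    | pending a k y b t ho hn ha => exact .pending a k _ b t (ho.succ (by simp [hFv])) hn ha
    | done k y b t j ho hj hs => exact .done k _ b t j (ho.succ (by simp [hFv])) hj hs
  | innerInternal p k x y h hx =>
    have h1 := hp p
    rw [h] at h1
    refine ⟨none, d, .none d, ⟨hb, stay' p _ (by simp [hFv]) ?_⟩, .inr ⟨rfl, p, rfl⟩, by simp⟩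
    generalize hz : d.proc p = z at h1 ⊢
    cases h1 with
    | pending a k y b t ho hn ha => exact .pending a k _ b t (ho.succ (by simp [hFv])) hn ha
    | done k y b t j ho hj hs => exact .done k _ b t j (ho.succ (by simp [hFv])) hj hs
  | innerRet p k x r m h hx =>
    have h1 := hp p
    rw [h] at h1
    refine ⟨none, d, .none d, ⟨hb, stay' p _ ?_ ?_⟩, .inr ⟨rfl, p, rfl⟩, by simp⟩
    · intro q hq y
      simp [hFv, Ne.symm hq]
    generalize hz : d.proc p = z at h1 ⊢
    cases h1 with
    | pending a k y b t ho hn ha =>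
      -- An operation that responds now has been passed, so it cannot still be pending in the
      -- simulation.
      obtain ⟨j, hj, hjt⟩ := hcomp t r (returns_iff.2 ⟨p, b, ho, hFv⟩)
      exact absurd hjt (hn j hj)
    | done k y b t j ho hj hjs =>
      -- Legality of the linearization: the actual response is the one that the atomic object gave
      -- at position `j`.
      rw [← hst j t p b hjs ho.1 T r (returns_iff.2 ⟨p, b, ho, hFv⟩)]
      exact .outer _ _

/-- Passing a gap does nothing. Passing an operation executes it atomically, which is possible
because it has been invoked but has neither returned nor been executed, so its caller in the
simulation still stands before the call. -/
theorem Sim.exists_pass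
    (hF : ∀ t, (F.cfg t).proc = fun p => innerProc (A := A) (B := B) ((E.cfg t).proc p))
    (hs : IsLinearization σ F.ev seq)
    (hst : ∀ k, (seq k = none → st (k + 1) = st k) ∧ ∀ t p b, seq k = some t →
      F.ev t = some (.inv p b) → st (k + 1) = (σ.step (st k) b).1)
    {s : ℕ} (hr : Ready seq (mergePath seq s)) {d : Config n A σ}
    (hd : Sim (A := A) (B := B) σ F.ev seq st (mergePath seq s)
      (E.cfg (mergePath seq s).1).proc d) :
    ∃ e d', Step n A σ d e d' ∧
      Sim (A := A) (B := B) σ F.ev seq st (mergePath seq (s + 1))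
        (E.cfg (mergePath seq (s + 1)).1).proc d' ∧
      (e = none ∨ ∃ p, e = some (.int p)) ∧ (seq (mergePath seq s).2 ≠ none → e ≠ none) := by
  have hcomp : ∀ t r y, Returns F.ev t r y → r < (mergePath seq s).1 →
      ∃ j, j < (mergePath seq s).2 ∧ seq j = some t :=
    fun t r y h hlt => mergePath_complete hs s h (.inl hlt)
  rw [mergePath_succ_of_ready hr]
  generalize mergePath seq s = x at *
  obtain ⟨T, K⟩ := x
  obtain ⟨hb, hp⟩ := hd
  simp only at *
  cases hK : seq K with
  | none =>
    exact ⟨none, d, .none d, ⟨by rw [(hst K).1 hK]; exact hb, fun p => (hp p).pass (by simp [hK])⟩,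
      .inl rfl, by simp⟩
  | some t =>
    obtain ⟨p, b, ht⟩ := hs.isOp K t hK
    have htT : t < T := by
      obtain ⟨k, hk, -, hk'⟩ := hr
      exact hk' K hk t hK
    -- the operation is still pending
    have hopen : ∀ T', t < T' → T' ≤ T → OpenAt F.ev p b t T' := by
      intro T'
      induction T' with
      | zero => intro h; omega
      | succ T' ih =>
        intro h1 h2
        rcases Nat.lt_succ_iff_lt_or_eq.1 h1 with h | rfl
        · have h3 := ih h (by omega)
          refine h3.succ fun y hy => ?_
          -- Had it returned before `T`, it would already occupy a position below `K`, and no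
          -- operation is listed twice.
          obtain ⟨j, hj, hj'⟩ := hcomp t T' y (returns_iff.2 ⟨p, b, h3, hy⟩) (by omega)
          exact hj.ne (hs.inj _ _ _ hj' hK)
        · exact .of_inv ht
    have ho := hopen T htT le_rfl
    obtain ⟨y, hy⟩ := ho.running
    rw [hF] at hy
    have h1 := hp p
    generalize hz : d.proc p = z at h1
    generalize hP : (E.cfg T).proc p = w at h1
    simp only [hP] at hy
    cases h1 with
    | idle a m => cases hy
    | outer a m => cases hy
    | done k y b' t' j ho' hj hjs =>
      obtain rfl := ho.unique ho'
      exact absurd (hs.inj _ _ _ hjs hK) hj.ne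
    | pending a k y b' t' ho' hn ha =>
      obtain rfl := ho.unique ho'
      obtain rfl : b = b' := by
        have := ho.1.symm.trans ho'.1
        simpa using this
      refine ⟨_, _, .call d p a b k hz ha, ⟨?_, fun q => ?_⟩, .inr ⟨p, rfl⟩, by simp⟩
      · simp only
        rw [(hst K).2 t p b hK ht, hb]
      · by_cases hq : q = p
        · subst hq
          simp only [Function.update_self]
          rw [hb, hP]
          exact .done k y b t K ho (Nat.lt_succ_self K) hK
        · simp only [Function.update_of_ne hq]
          refine (hp q).pass fun b' t' ho' h => ?_
          rw [hK] at h
          obtain rfl : t = t' := by simpa using h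
          have := ho'.1.symm.trans ht
          simp [hq] at this

end Simulation

/-- Dependent choice, keeping an invariant `S` and a relation `r` between consecutive terms. -/
theorem exists_chain {α : Type*} {S : ℕ → α → Prop} {r : ℕ → α → α → Prop} {a : α} (h0 : S 0 a)
    (h : ∀ s x, S s x → ∃ y, S (s + 1) y ∧ r s x y) :
    ∃ f : ℕ → α, f 0 = a ∧ ∀ s, S s (f s) ∧ r s (f s) (f (s + 1)) := by
  choose g hg using h
  let f : ∀ s, {x // S s x} := fun s =>
    Nat.rec ⟨a, h0⟩ (fun s x => ⟨g s x.1 x.2, (hg s x.1 x.2).1⟩) s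
  exact ⟨fun s => (f s).1, rfl, fun s => ⟨(f s).2, (hg s _ (f s).2).2⟩⟩

/-- Every execution of `A` composed with a linearizable implementation `B` of its base object has
the same history, up to stretching, as an execution of `A` on the atomic base object. If moreover
`B` is non-blocking and infinitely many steps are taken in the first execution, then also in the
second. -/
theorem exists_atomic_execution (hlin : Linearizable n B β σ) (hnb : NonBlocking n B β)
    (E : Execution n (A.comp B) β) :
    ∃ (E' : Execution n A σ) (φ : ℕ → ℕ), Stretch E.ev E'.ev φ ∧
      ((∃ᶠ t in Filter.atTop, E.ev t ≠ none) → ∃ᶠ t in Filter.atTop, E'.ev t ≠ none) := by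
  obtain ⟨F, hF⟩ := E.exists_inner
  obtain ⟨seq, hs⟩ := hlin F
  obtain ⟨st, h0, hst⟩ := hs.legal
  obtain ⟨f, hf0, hf⟩ := exists_chain (α := Config n A σ) (a := ⟨σ.init, fun _ => .inl A.init⟩)
    (S := fun s d => Sim (A := A) (B := B) σ F.ev seq st (mergePath seq s)
      (E.cfg (mergePath seq s).1).proc d)
    (r := fun s d d' => ∃ e, Step n A σ d e d' ∧
      (Ready seq (mergePath seq s) → (e = none ∨ ∃ p, e = some (.int p)) ∧
        (seq (mergePath seq s).2 ≠ none → e ≠ none)) ∧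
      (¬ Ready seq (mergePath seq s) →
        (e = E.ev (mergePath seq s).1 ∨
          e = none ∧ ∃ p, E.ev (mergePath seq s).1 = some (.int p)) ∧
        (F.ev (mergePath seq s).1 = none → e = E.ev (mergePath seq s).1)))
    ⟨h0.symm, fun p => by
      simp only [mergePath, E.init_proc]
      exact .idle A.init B.init⟩
    (by
      intro s d hd
      by_cases hr : Ready seq (mergePath seq s)
      · obtain ⟨e, d', h1, h2, h3⟩ := hd.exists_pass (fun t => (hF t).2) hs
          (fun k => ⟨(hst k).1, fun t p b hk ht => ((hst k).2 t p b hk ht).1⟩) hr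
        exact ⟨d', h2, e, h1, fun _ => h3, fun h => absurd hr h⟩
      · obtain ⟨e, d', h1, h2, h3⟩ := hd.exists_advance (fun t => (hF t).1) hs
          (fun k t p b hk ht => ((hst k).2 t p b hk ht).2) hr
        exact ⟨d', h2, e, h1, fun h => absurd h hr, fun _ => h3⟩)
  choose e hstep hready hadv using fun s => (hf s).2
  -- `φ T` is the index of the merged path at which step `T` of the history is taken.
  choose φ hφ hφr using exists_mergePath_advance hs.inj
  have hmono : StrictMono φ := by
    refine strictMono_nat_of_lt_succ fun T => ?_
    by_contra hle
    have := (mergePath_monotone (seq := seq) (not_lt.1 hle)).1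
    rw [hφ, hφ] at this
    omega
  have huniq : ∀ s, ¬ Ready seq (mergePath seq s) → φ (mergePath seq s).1 = s := by
    intro s hr
    rcases lt_trichotomy (φ (mergePath seq s).1) s with h | h | h
    · have := mergePath_le_of_lt (hφr _) h
      rw [hφ] at this
      omega
    · exact h
    · have := mergePath_le_of_lt hr h
      rw [hφ] at this
      omega
  refine ⟨⟨f, e, by rw [hf0], fun p => by rw [hf0], hstep⟩, φ, ⟨hmono, ?_, ?_, ?_, ?_⟩, ?_⟩
  · intro T p o
    have := (hadv (φ T) (hφr T)).1
    rw [hφ] at this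
    rcases this with h | ⟨h, q, hq⟩
    · simp only [h]
    · simp [h, hq]
  · intro T p o
    have := (hadv (φ T) (hφr T)).1
    rw [hφ] at this
    rcases this with h | ⟨h, q, hq⟩
    · simp only [h]
    · simp [h, hq]
  · intro s p o h
    by_cases hr : Ready seq (mergePath seq s)
    · rcases (hready s hr).1 with h' | ⟨q, h'⟩ <;> simp [h'] at h
    · exact ⟨_, huniq s hr⟩
  · intro s p y h
    by_cases hr : Ready seq (mergePath seq s)
    · rcases (hready s hr).1 with h' | ⟨q, h'⟩ <;> simp [h'] at h
    · exact ⟨_, huniq s hr⟩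
  · intro hfreq
    by_cases hFf : ∃ᶠ t in Filter.atTop, F.ev t ≠ none
    · by_contra hcon
      obtain ⟨N, hN⟩ := Filter.eventually_atTop.1 (Filter.not_frequently.1 hcon)
      simp only [not_not] at hN
      -- If the simulation is idle from `N` on, only gaps are passed from then on. Hence every inner
      -- operation that returns was listed before that, and so invoked before `(mergePath seq N).1`.
      have hnone : ∀ s, N ≤ s → ∀ j, (mergePath seq N).2 ≤ j → j < (mergePath seq s).2 →
          seq j = none := by
        intro s hs'
        induction s, hs' using Nat.le_induction with
        | base => intro j h1 h2; omega
        | succ s hs' ih =>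
          intro j h1 h2
          by_cases hr : Ready seq (mergePath seq s)
          · rw [mergePath_succ_of_ready hr] at h2
            rcases Nat.lt_succ_iff_lt_or_eq.1 h2 with h | rfl
            · exact ih j h1 h
            · by_contra hne
              exact (hready s hr).2 hne (hN s hs')
          · rw [mergePath_succ_of_not_ready hr] at h2
            exact ih j h1 h2
      have hret : ∀ t r y, Returns F.ev t r y → t < (mergePath seq N).1 := by
        intro t r y hr
        obtain ⟨j, hj, hjt⟩ := mergePath_complete hs (max N (φ (r + 1))) hr (.inl (by
          have := (mergePath_monotone (seq := seq) (le_max_right N (φ (r + 1)))).1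
          rw [hφ] at this
          omega))
        refine mergePath_lt N (j := j) ?_ hjt
        by_contra hle
        have := hnone _ (le_max_left _ _) j (by omega) hj
        simp [hjt] at this
      have hinf := Nat.frequently_atTop_iff_infinite.1 (hnb F hFf)
      have : ∀ r, ∃ t, ∀ p y, F.ev r = some (.res p y) → Returns F.ev t r y := by
        intro r
        by_cases h : ∃ p y, F.ev r = some (.res p y)
        · obtain ⟨p, y, h⟩ := h
          obtain ⟨t, ht⟩ := F.exists_returns h
          refine ⟨t, fun p' y' h' => ?_⟩
          rw [h] at h'
          obtain ⟨rfl, rfl⟩ : p = p' ∧ y = y' := by simpa using h'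
          exact ht
        · exact ⟨0, fun p y hy => absurd ⟨p, y, hy⟩ h⟩
      -- Sending a response to its invocation is injective, so finitely many invocations cannot
      -- account for infinitely many inner responses.
      choose g hg using this
      refine hinf (Set.Finite.of_finite_image (f := g)
        ((Set.finite_Iio (mergePath seq N).1).subset ?_) ?_)
      · rintro _ ⟨r, ⟨p, y, hy⟩, rfl⟩
        exact hret _ _ _ (hg r p y hy)
      · rintro r ⟨p, y, hy⟩ r' ⟨p', y', hy'⟩ h
        have h1 := hg r p y hy
        rw [h] at h1
        exact (h1.unique (hg r' p' y' hy')).1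
    -- If the inner execution is eventually idle, all later steps are outer steps, which the
    -- simulation copies.
    · have h1 := hfreq.and_eventually (Filter.not_frequently.1 hFf)
      rw [Filter.frequently_atTop] at h1 ⊢
      intro N
      obtain ⟨T, hT, hne, hT'⟩ := h1 N
      refine ⟨φ T, hT.trans hmono.le_apply, ?_⟩
      have := (hadv (φ T) (hφr T)).2
      rw [hφ] at this
      simp only
      rw [this (not_not.1 hT')]
      exact hne

theorem Linearizable.comp {τ : SeqSpec Op Res} (hA : Linearizable n A σ τ)
    (hlin : Linearizable n B β σ) (hnb : NonBlocking n B β) :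
    Linearizable n (A.comp B) β τ := by
  intro E
  obtain ⟨E', φ, hφ, -⟩ := exists_atomic_execution (A := A) hlin hnb E
  obtain ⟨seq', h⟩ := hA E'
  exact hφ.exists_linearization h

theorem NonBlocking.comp (hA : NonBlocking n A σ) (hlin : Linearizable n B β σ)
    (hnb : NonBlocking n B β) : NonBlocking n (A.comp B) β := by
  intro E hE
  obtain ⟨E', φ, hφ, hfreq⟩ := exists_atomic_execution (A := A) hlin hnb E
  have h := hA E' (hfreq hE)
  rw [Filter.frequently_atTop] at h ⊢
  intro N
  obtain ⟨s, hs, p, r, hr⟩ := h (φ N)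
  obtain ⟨T, rfl⟩ := hφ.range_res _ _ _ hr
  exact ⟨T, hφ.strictMono.le_iff_le.1 hs, p, r, (hφ.res_iff _ _ _).2 hr⟩

end Composition

/-! ### Steps of the weak set algorithm -/

section WeakSet

variable {n : ℕ} {V : Type*}

/-- A step of the weak set algorithm on an atomic snapshot object: `R` is the array and `P` gives
the local states of the processes. -/
inductive WSStep [NeZero n] (R : Fin n → Set V) (P : Fin n → Set V ⊕ WSRun n V) :
    Option (Event n (SetOp V) (SetRes V)) → (Fin n → Set V) → (Fin n → Set V ⊕ WSRun n V) → Prop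
  | none : WSStep R P none R P
  | invAdd (p : Fin n) (v : V) (w : Set V) (h : P p = .inl w) :
      WSStep R P (some (.inv p (.add v))) R (Function.update P p (.inr (.addScan v 0 w)))
  | invGet (p : Fin n) (w : Set V) (h : P p = .inl w) :
      WSStep R P (some (.inv p .get)) R (Function.update P p (.inr (.getScan 0 w)))
  | addScanMore (p : Fin n) (v : V) (x : Fin n) (w : Set V) (h : P p = .inr (.addScan v x w))
      (hR : ¬ ∀ i, v ∈ R i) :
      WSStep R P (some (.int p)) R
        (Function.update P p (.inr (.addUpdate v x (w ∪ (⋃ i, R i) ∪ {v}))))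
  | addScanFull (p : Fin n) (v : V) (x : Fin n) (w : Set V) (h : P p = .inr (.addScan v x w))
      (hR : ∀ i, v ∈ R i) :
      WSStep R P (some (.int p)) R
        (Function.update P p (.inr (.addReturn (w ∪ (⋃ i, R i) ∪ {v}))))
  | addUpdate (p : Fin n) (v : V) (x : Fin n) (w : Set V) (h : P p = .inr (.addUpdate v x w)) :
      WSStep R P (some (.int p)) (Function.update R x w)
        (Function.update P p (.inr (.addScan v (x + 1) w)))
  | addReturn (p : Fin n) (w : Set V) (h : P p = .inr (.addReturn w)) :
      WSStep R P (some (.res p .ack)) R (Function.update P p (.inl w))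
  | getScanMore (p : Fin n) (x : Fin n) (w : Set V) (h : P p = .inr (.getScan x w))
      (hR : ¬ ∀ i, R i = w ∪ ⋃ i, R i) :
      WSStep R P (some (.int p)) R (Function.update P p (.inr (.getUpdate x (w ∪ ⋃ i, R i))))
  | getScanFull (p : Fin n) (x : Fin n) (w : Set V) (h : P p = .inr (.getScan x w))
      (hR : ∀ i, R i = w ∪ ⋃ i, R i) :
      WSStep R P (some (.int p)) R (Function.update P p (.inr (.getReturn (w ∪ ⋃ i, R i))))
  | getUpdate (p : Fin n) (x : Fin n) (w : Set V) (h : P p = .inr (.getUpdate x w)) :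
      WSStep R P (some (.int p)) (Function.update R x w)
        (Function.update P p (.inr (.getScan (x + 1) w)))
  | getReturn (p : Fin n) (w : Set V) (h : P p = .inr (.getReturn w)) :
      WSStep R P (some (.res p (.vals w))) R (Function.update P p (.inl w))

/-- Turns the counting tests of the loops into quantifiers; it also serves the pigeonhole argument
on `lackCount`. -/
theorem ncard_lt_iff_not_forall {p : Fin n → Prop} : {r | p r}.ncard < n ↔ ¬ ∀ r, p r := by
  constructor
  · intro h hall
    rw [show {r | p r} = Set.univ from Set.eq_univ_of_forall hall, Set.ncard_univ] at h
    simp at h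
  · intro h
    have : {r | p r} ⊂ Set.univ :=
      Set.ssubset_univ_iff.2 fun h' => h fun r => by
        have : r ∈ {r | p r} := h' ▸ Set.mem_univ r
        exact this
    simpa [Set.ncard_univ] using Set.ncard_lt_ncard this

variable [NeZero n]

theorem WSStep.addScan {R : Fin n → Set V} {P : Fin n → Set V ⊕ WSRun n V} {p : Fin n} {v : V}
    {x : Fin n} {w : Set V} (h : P p = .inr (.addScan v x w)) :
    WSStep R P (some (.int p)) R
      (Function.update P p (.inr (addTest v x (w ∪ (⋃ i, R i) ∪ {v}) R))) := by
  by_cases hR : ∀ i, v ∈ R i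
  · rw [addTest, if_neg (by rw [ncard_lt_iff_not_forall]; exact not_not.2 hR)]
    exact .addScanFull p v x w h hR
  · rw [addTest, if_pos (ncard_lt_iff_not_forall.2 hR)]
    exact .addScanMore p v x w h hR

theorem WSStep.getScan {R : Fin n → Set V} {P : Fin n → Set V ⊕ WSRun n V} {p x : Fin n}
    {w : Set V} (h : P p = .inr (.getScan x w)) :
    WSStep R P (some (.int p)) R (Function.update P p (.inr (getTest x (w ∪ ⋃ i, R i) R))) := by
  by_cases hR : ∀ i, w ∪ ⋃ i, R i = R i
  · rw [getTest, if_neg (by rw [ncard_lt_iff_not_forall]; exact not_not.2 hR)]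
    exact .getScanFull p x w h fun i => (hR i).symm
  · rw [getTest, if_pos (ncard_lt_iff_not_forall.2 hR)]
    exact .getScanMore p x w h fun h => hR fun i => (h i).symm

theorem Step.wsStep {c c' : Config n (weakSet n V) (snapshot n V)}
    {e : Option (Event n (SetOp V) (SetRes V))} (h : Step n (weakSet n V) (snapshot n V) c e c') :
    WSStep (V := V) c.base c.proc e c'.base c'.proc := by
  cases h with
  | none => exact .none
  | inv p o m h =>
    cases o with
    | add v => exact .invAdd p v m h
    | get => exact .invGet p m h
  | call p x b k h hx =>
    cases x with
    | addScan v x w => cases hx; exact .addScan h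
    | addUpdate v x w => cases hx; exact .addUpdate p v x w h
    | addReturn w => cases hx
    | getScan x w => cases hx; exact .getScan h
    | getUpdate x w => cases hx; exact .getUpdate p x w h
    | getReturn w => cases hx
  | internal p x y h hx => cases x <;> cases hx
  | ret p x r m h hx =>
    cases x with
    | addReturn w => cases hx; exact .addReturn p _ h
    | getReturn w => cases hx; exact .getReturn p _ h
    | _ => cases hx

/-- An execution of the weak set algorithm, with array `R t` and local states `P t` at time `t`. -/
structure WSExec (R : ℕ → Fin n → Set V) (P : ℕ → Fin n → Set V ⊕ WSRun n V)
    (ev : ℕ → Option (Event n (SetOp V) (SetRes V))) : Prop where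
  init_array : ∀ i, R 0 i = ∅
  init_proc : ∀ p, P 0 p = .inl ∅
  step : ∀ t, WSStep (R t) (P t) (ev t) (R (t + 1)) (P (t + 1))

theorem Execution.wsExec (E : Execution n (weakSet n V) (snapshot n V)) :
    WSExec (V := V) (fun t => (E.cfg t).base) (fun t => (E.cfg t).proc) E.ev :=
  ⟨fun i => by rw [E.init_base]; rfl, E.init_proc, fun t => (E.step t).wsStep⟩

/-! ### Invariants -/

/-- The set of arguments of the `add` operations invoked before step `T`. -/
def added (ev : ℕ → Option (Event n (SetOp V) (SetRes V))) (T : ℕ) : Set V :=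
  {v | ∃ t p, t < T ∧ ev t = some (.inv p (.add v))}

omit [NeZero n] in
theorem added_mono (ev : ℕ → Option (Event n (SetOp V) (SetRes V))) : Monotone (added ev) := by
  rintro T T' h v ⟨t, p, ht, hv⟩
  exact ⟨t, p, by omega, hv⟩

/-- The values that a process knows: its view and the argument of its current operation. -/
def known : Set V ⊕ WSRun n V → Set V
  | .inl w => w
  | .inr (.addScan v _ w) => insert v w
  | .inr (.addUpdate v _ w) => insert v w
  | .inr (.addReturn w) => w
  | .inr (.getScan _ w) => w
  | .inr (.getUpdate _ w) => w
  | .inr (.getReturn w) => w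

variable {R : ℕ → Fin n → Set V} {P : ℕ → Fin n → Set V ⊕ WSRun n V}
  {ev : ℕ → Option (Event n (SetOp V) (SetRes V))}

omit [NeZero n] in
theorem forall_update {α : Type*} {P : Fin n → α} {p : Fin n} {x : α} {Q : α → Prop}
    (h : ∀ q, Q (P q)) (hx : Q x) (q : Fin n) : Q (Function.update P p x q) := by
  by_cases hq : q = p
  · subst hq; simpa using hx
  · simpa [hq] using h q

/-- Values enter the system only as arguments of `add`; scans and updates merely copy them. This is
used both for the values returned by `get` and for the finiteness of the views. -/
theorem WSExec.subset_added (h : WSExec R P ev) (T : ℕ) :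
    (∀ i, R T i ⊆ added ev T) ∧ ∀ p, known (P T p) ⊆ added ev T := by
  induction T with
  | zero => exact ⟨fun i => by simp [h.init_array], fun p => by simp [h.init_proc, known]⟩
  | succ T ih =>
    have hm := added_mono ev (Nat.le_succ T)
    have ihR : ∀ i, R T i ⊆ added ev (T + 1) := fun i => (ih.1 i).trans hm
    have ihP : ∀ p, known (P T p) ⊆ added ev (T + 1) := fun p => (ih.2 p).trans hm
    have ihU : ⋃ i, R T i ⊆ added ev (T + 1) := Set.iUnion_subset ihR
    have hs := h.step T
    generalize hR' : R (T + 1) = R' at hs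
    generalize hP' : P (T + 1) = P' at hs
    generalize hev : ev T = e at hs
    cases hs with
    | none => exact ⟨ihR, ihP⟩
    | invAdd p v w hp =>
      have h1 := ihP p
      rw [hp] at h1
      exact ⟨ihR, forall_update (Q := fun s => known s ⊆ _) ihP
        (Set.insert_subset ⟨T, p, by omega, hev⟩ h1)⟩
    | invGet p w hp =>
      have h1 := ihP p
      rw [hp] at h1
      exact ⟨ihR, forall_update (Q := fun s => known s ⊆ _) ihP h1⟩
    | addScanMore p v x w hp hR =>
      have h1 := ihP p
      rw [hp] at h1
      obtain ⟨h2, h3⟩ := Set.insert_subset_iff.1 h1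
      exact ⟨ihR, forall_update (Q := fun s => known s ⊆ _) ihP (Set.insert_subset h2
        (Set.union_subset (Set.union_subset h3 ihU) (Set.singleton_subset_iff.2 h2)))⟩
    | addScanFull p v x w hp hR =>
      have h1 := ihP p
      rw [hp] at h1
      obtain ⟨h2, h3⟩ := Set.insert_subset_iff.1 h1
      exact ⟨ihR, forall_update (Q := fun s => known s ⊆ _) ihP
        (Set.union_subset (Set.union_subset h3 ihU) (Set.singleton_subset_iff.2 h2))⟩
    | addUpdate p v x w hp =>
      have h1 := ihP p
      rw [hp] at h1
      exact ⟨forall_update (Q := fun s : Set V => s ⊆ added ev (T + 1)) ihR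
          (Set.insert_subset_iff.1 h1).2,
        forall_update (Q := fun s => known s ⊆ _) ihP h1⟩
    | addReturn p w hp =>
      have h1 := ihP p
      rw [hp] at h1
      exact ⟨ihR, forall_update (Q := fun s => known s ⊆ _) ihP h1⟩
    | getScanMore p x w hp hR =>
      have h1 := ihP p
      rw [hp] at h1
      exact ⟨ihR, forall_update (Q := fun s => known s ⊆ _) ihP (Set.union_subset h1 ihU)⟩
    | getScanFull p x w hp hR =>
      have h1 := ihP p
      rw [hp] at h1
      exact ⟨ihR, forall_update (Q := fun s => known s ⊆ _) ihP (Set.union_subset h1 ihU)⟩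
    | getUpdate p x w hp =>
      have h1 := ihP p
      rw [hp] at h1
      exact ⟨forall_update (Q := fun s : Set V => s ⊆ added ev (T + 1)) ihR h1,
        forall_update (Q := fun s => known s ⊆ _) ihP h1⟩
    | getReturn p w hp =>
      have h1 := ihP p
      rw [hp] at h1
      exact ⟨ihR, forall_update (Q := fun s => known s ⊆ _) ihP h1⟩

/-! ### Persistence of a value that has filled the array -/

/-- The process is about to overwrite a component with a set that does not contain `v`. -/
def Stale (v : V) : Set V ⊕ WSRun n V → Prop
  | .inr (.addUpdate _ _ w) => v ∉ w
  | .inr (.getUpdate _ w) => v ∉ w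
  | _ => False

/-- The number of components that do not contain `v` and of processes about to overwrite a component
with a set that does not contain `v`. -/
noncomputable def lackCount (v : V) (R : Fin n → Set V) (P : Fin n → Set V ⊕ WSRun n V) : ℕ :=
  {i | v ∉ R i}.ncard + {p | Stale v (P p)}.ncard

omit [NeZero n] in
theorem exists_mem_of_lackCount_lt {v : V} {R : Fin n → Set V} {P : Fin n → Set V ⊕ WSRun n V}
    (h : lackCount v R P < n) : ∃ i, v ∈ R i := by
  have h1 : {i | v ∉ R i}.ncard < n := by rw [lackCount] at h; omega
  simpa using ncard_lt_iff_not_forall.1 h1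

omit [NeZero n] in
theorem lackCount_update_proc_le {v : V} {R : Fin n → Set V} {P : Fin n → Set V ⊕ WSRun n V}
    {p : Fin n} {x : Set V ⊕ WSRun n V} (hx : ¬ Stale v x) :
    lackCount v R (Function.update P p x) ≤ lackCount v R P := by
  refine Nat.add_le_add_left (Set.ncard_le_ncard fun q hq => ?_) _
  by_cases h : q = p
  · subst h; simp [hx] at hq
  · simpa [h] using hq

-- A write lacking `v` may spoil one more component, but the writer then leaves the set of stale
-- processes, so the sum does not grow.
omit [NeZero n] in
theorem lackCount_update_le {v : V} {R : Fin n → Set V} {P : Fin n → Set V ⊕ WSRun n V}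
    {p i : Fin n} {x : Set V ⊕ WSRun n V} {w : Set V} (hx : ¬ Stale v x)
    (hw : v ∈ w ∨ Stale v (P p)) :
    lackCount v (Function.update R i w) (Function.update P p x) ≤ lackCount v R P := by
  by_cases hv : v ∈ w
  · refine le_trans (Nat.add_le_add_right (Set.ncard_le_ncard fun j hj => ?_) _)
      (lackCount_update_proc_le hx)
    by_cases h : j = i
    · subst h; simp [hv] at hj
    · simpa [h] using hj
  · have hP := hw.resolve_left hv
    have h1 : {j | v ∉ Function.update R i w j}.ncard ≤ {j | v ∉ R j}.ncard + 1 := by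
      refine le_trans (Set.ncard_le_ncard (t := insert i {j | v ∉ R j}) fun j hj => ?_)
        (Set.ncard_insert_le _ _)
      by_cases h : j = i
      · exact .inl h
      · right; simpa [h] using hj
    have h2 : {q | Stale v (Function.update P p x q)}.ncard < {q | Stale v (P q)}.ncard := by
      refine Set.ncard_lt_ncard ⟨fun q hq => ?_, fun h => ?_⟩
      · by_cases h : q = p
        · subst h; simp [hx] at hq
        · simpa [h] using hq
      · have := h hP
        simp [hx] at this
    unfold lackCount
    omega

/-- The bound keeps itself alive: it guarantees a component containing `v`, hence every scan learns
`v` and makes no process stale. -/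
theorem WSStep.lackCount_lt {R R' : Fin n → Set V} {P P' : Fin n → Set V ⊕ WSRun n V}
    {e : Option (Event n (SetOp V) (SetRes V))} (h : WSStep R P e R' P') {v : V}
    (hlt : lackCount v R P < n) : lackCount v R' P' < n := by
  obtain ⟨i, hi⟩ := exists_mem_of_lackCount_lt hlt
  have hU : v ∈ ⋃ i, R i := Set.mem_iUnion.2 ⟨i, hi⟩
  refine lt_of_le_of_lt ?_ hlt
  cases h with
  | none => exact le_rfl
  | addScanMore p u x w hp hR =>
    exact lackCount_update_proc_le (by rw [Stale]; exact fun h => h (.inl (.inr hU)))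
  | getScanMore p x w hp hR =>
    exact lackCount_update_proc_le (by rw [Stale]; exact fun h => h (.inr hU))
  | addUpdate p u x w hp =>
    exact lackCount_update_le (fun h => h) (by rw [hp]; exact em _)
  | getUpdate p x w hp =>
    exact lackCount_update_le (fun h => h) (by rw [hp]; exact em _)
  | _ => exact lackCount_update_proc_le (fun h => h)

/-- Only an update can complete the filling, and the updating process goes on to a scan: at most `n
- 1` processes are stale and no component lacks `v`. -/
theorem WSStep.lackCount_lt_of_full {R R' : Fin n → Set V} {P P' : Fin n → Set V ⊕ WSRun n V}
    {e : Option (Event n (SetOp V) (SetRes V))} (h : WSStep R P e R' P') {v : V}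
    (h1 : ¬ ∀ i, v ∈ R i) (h2 : ∀ i, v ∈ R' i) : lackCount v R' P' < n := by
  have key : ∀ p, ¬ Stale v (P' p) → lackCount v R' P' < n := by
    intro p hp
    have h3 : {i | v ∉ R' i}.ncard = 0 := by simp [h2]
    have h4 : {q | Stale v (P' q)}.ncard < n :=
      ncard_lt_iff_not_forall.2 fun h => hp (h p)
    rw [lackCount, h3]
    omega
  cases h with
  | addUpdate p u x w hp => exact key p (by simp [Stale])
  | getUpdate p x w hp => exact key p (by simp [Stale])
  | _ => exact absurd h2 h1

/-- Once all components have contained `v`, some component always contains `v`. -/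
theorem WSExec.exists_mem_of_le (h : WSExec R P ev) {v : V} {s T : ℕ} (hs : ∀ i, v ∈ R s i)
    (hT : s ≤ T) : ∃ i, v ∈ R T i := by
  classical
  have hex : ∃ s, ∀ i, v ∈ R s i := ⟨s, hs⟩
  refine exists_mem_of_lackCount_lt (P := P T) ?_
  have hle := (Nat.find_min' hex hs).trans hT
  -- Start from the first full time. It is not `0`, since component `0` exists and is initially
  -- empty, so a step leads to it.
  obtain ⟨m, hm⟩ : ∃ m, Nat.find hex = m + 1 := by
    refine Nat.exists_eq_succ_of_ne_zero fun h0 => ?_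
    have := Nat.find_spec hex
    rw [h0] at this
    simpa [h.init_array] using this 0
  rw [hm] at hle
  clear hT
  induction T, hle using Nat.le_induction with
  | base =>
    exact (h.step m).lackCount_lt_of_full (Nat.find_min hex (by omega)) (hm ▸ Nat.find_spec hex)
  | succ T hT ih =>
    exact (h.step T).lackCount_lt ih

/-! ### What a returning operation has seen -/

/-- What the local state of a process says about its operation `o` invoked at step `t`, before
step `T`. -/
inductive OpInv (R : ℕ → Fin n → Set V) (t T : ℕ) : SetOp V → Set V ⊕ WSRun n V → Prop
  | addScan (v : V) (x : Fin n) (w : Set V) : OpInv R t T (.add v) (.inr (.addScan v x w))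
  | addUpdate (v : V) (x : Fin n) (w : Set V) : OpInv R t T (.add v) (.inr (.addUpdate v x w))
  | addReturn (v : V) (w : Set V) (u : ℕ) (h1 : t < u) (h2 : u < T) (h3 : ∀ i, v ∈ R u i) :
      OpInv R t T (.add v) (.inr (.addReturn w))
  | getScan (x : Fin n) (w : Set V) : OpInv R t T .get (.inr (.getScan x w))
  | getUpdate (x : Fin n) (w : Set V) : OpInv R t T .get (.inr (.getUpdate x w))
  | getReturn (w : Set V) (u : ℕ) (h1 : t < u) (h2 : u < T) (h3 : ∀ i, R u i = w) :
      OpInv R t T .get (.inr (.getReturn w))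

omit [NeZero n] in
theorem OpInv.succ {t T : ℕ} {o : SetOp V} {x : Set V ⊕ WSRun n V} (h : OpInv R t T o x) :
    OpInv R t (T + 1) o x := by
  cases h with
  | addScan v x w => exact .addScan v x w
  | addUpdate v x w => exact .addUpdate v x w
  | addReturn v w u h1 h2 h3 => exact .addReturn v w u h1 (by omega) h3
  | getScan x w => exact .getScan x w
  | getUpdate x w => exact .getUpdate x w
  | getReturn w u h1 h2 h3 => exact .getReturn w u h1 (by omega) h3

/-- The return states are reached only by a scan that passes the loop test; the time of that scan is
the recorded `u`. -/
theorem WSExec.opInv (h : WSExec R P ev) {p : Fin n} {o : SetOp V} {t T : ℕ}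
    (ho : OpenAt ev p o t T) : OpInv R t T o (P T p) := by
  induction T with
  | zero => exact absurd ho.2.1 (by omega)
  | succ T ih =>
    have hs := h.step T
    rcases Nat.lt_succ_iff_lt_or_eq.1 ho.2.1 with hlt | rfl
    · have hnr := ho.2.2 T hlt (by omega)
      specialize ih (ho.mono hlt (by omega))
      generalize hR' : R (T + 1) = R' at hs
      generalize P (T + 1) = P' at hs ⊢
      generalize hev : ev T = e at hs hnr
      cases hs with
      | none => exact ih.succ
      | invAdd q v w hq =>
        by_cases hpq : p = q
        · subst hpq; rw [hq] at ih; cases ih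
        · rw [Function.update_of_ne hpq]; exact ih.succ
      | invGet q w hq =>
        by_cases hpq : p = q
        · subst hpq; rw [hq] at ih; cases ih
        · rw [Function.update_of_ne hpq]; exact ih.succ
      | addScanMore q v x w hq hR =>
        by_cases hpq : p = q
        · subst hpq; rw [hq] at ih; cases ih; rw [Function.update_self]; exact .addUpdate _ _ _
        · rw [Function.update_of_ne hpq]; exact ih.succ
      | addScanFull q v x w hq hR =>
        by_cases hpq : p = q
        · subst hpq; rw [hq] at ih; cases ih; rw [Function.update_self]
          exact .addReturn _ _ T hlt (by omega) hR
        · rw [Function.update_of_ne hpq]; exact ih.succ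
      | addUpdate q v x w hq =>
        by_cases hpq : p = q
        · subst hpq; rw [hq] at ih; cases ih; rw [Function.update_self]; exact .addScan _ _ _
        · rw [Function.update_of_ne hpq]; exact ih.succ
      | addReturn q w hq =>
        by_cases hpq : p = q
        · subst hpq; exact absurd rfl (hnr _)
        · rw [Function.update_of_ne hpq]; exact ih.succ
      | getScanMore q x w hq hR =>
        by_cases hpq : p = q
        · subst hpq; rw [hq] at ih; cases ih; rw [Function.update_self]; exact .getUpdate _ _
        · rw [Function.update_of_ne hpq]; exact ih.succ
      | getScanFull q x w hq hR =>
        by_cases hpq : p = q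
        · subst hpq; rw [hq] at ih; cases ih; rw [Function.update_self]
          exact .getReturn _ T hlt (by omega) hR
        · rw [Function.update_of_ne hpq]; exact ih.succ
      | getUpdate q x w hq =>
        by_cases hpq : p = q
        · subst hpq; rw [hq] at ih; cases ih; rw [Function.update_self]; exact .getScan _ _
        · rw [Function.update_of_ne hpq]; exact ih.succ
      | getReturn q w hq =>
        by_cases hpq : p = q
        · subst hpq; exact absurd rfl (hnr _)
        · rw [Function.update_of_ne hpq]; exact ih.succ
    · rw [ho.1] at hs
      generalize P (t + 1) = P' at hs ⊢
      generalize R (t + 1) = R' at hs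
      cases hs with
      | invAdd _ v w hq => rw [Function.update_self]; exact .addScan _ _ _
      | invGet _ w hq => rw [Function.update_self]; exact .getScan _ _

/-- A terminated `add v` returns `ack`, and a scan in it has found `v` in all components. -/
theorem WSExec.returns_add (h : WSExec R P ev) {p : Fin n} {v : V} {t r : ℕ} {y : SetRes V}
    (ht : ev t = some (.inv p (.add v))) (hr : Returns ev t r y) :
    y = .ack ∧ ∃ u, t < u ∧ u < r ∧ ∀ i, v ∈ R u i := by
  obtain ⟨p', o', ho, hy⟩ := returns_iff.1 hr
  obtain ⟨rfl, rfl⟩ : p' = p ∧ o' = .add v := by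
    have := ho.1.symm.trans ht
    simpa using this
  have hi := h.opInv ho
  have hs := h.step r
  rw [hy] at hs
  generalize R (r + 1) = R', P (r + 1) = P' at hs
  cases hs with
  | addReturn _ w hq =>
    rw [hq] at hi
    cases hi with
    | addReturn _ _ u h1 h2 h3 => exact ⟨rfl, u, h1, h2, h3⟩
  | getReturn _ w hq => rw [hq] at hi; cases hi

/-- A terminated `get` returns a set that a scan in it has found in all components. -/
theorem WSExec.returns_get (h : WSExec R P ev) {p : Fin n} {t r : ℕ} {y : SetRes V}
    (ht : ev t = some (.inv p .get)) (hr : Returns ev t r y) :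
    ∃ S, y = .vals S ∧ ∃ u, t < u ∧ u < r ∧ ∀ i, R u i = S := by
  obtain ⟨p', o', ho, hy⟩ := returns_iff.1 hr
  obtain ⟨rfl, rfl⟩ : p' = p ∧ o' = .get := by
    have := ho.1.symm.trans ht
    simpa using this
  have hi := h.opInv ho
  have hs := h.step r
  rw [hy] at hs
  generalize R (r + 1) = R', P (r + 1) = P' at hs
  cases hs with
  | addReturn _ w hq => rw [hq] at hi; cases hi
  | getReturn _ w hq =>
    rw [hq] at hi
    cases hi with
    | getReturn _ u h1 h2 h3 => exact ⟨w, rfl, u, h1, h2, h3⟩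

end WeakSet

/-! ### Linearization points -/

section Points

variable {n : ℕ} [NeZero n] {V : Type*} {E : Execution n (weakSet n V) (snapshot n V)}

theorem FirstFull.unique {S : Set V} {s s' : ℕ} (h : FirstFull E S s) (h' : FirstFull E S s') :
    s = s' :=
  IsLeast.unique h h'

theorem exists_firstFull {S : Set V} {u : ℕ}
    (h : ∀ i : Fin n, S ⊆ (show Fin n → Set V from (E.cfg u).base) i) :
    ∃ s, s ≤ u ∧ FirstFull E S s := by
  classical
  have hex : ∃ s, ∀ i : Fin n, S ⊆ (show Fin n → Set V from (E.cfg s).base) i := ⟨u, h⟩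
  exact ⟨Nat.find hex, Nat.find_min' hex h, Nat.find_spec hex, fun s hs => Nat.find_min' hex hs⟩

theorem linPoint_add_iff {p : Fin n} {v : V} {t τ : ℕ} (ht : E.ev t = some (.inv p (.add v))) :
    LinPoint E t τ ↔ ∃ s, FirstFull E {v} s ∧ τ = max s t := by
  constructor
  · rintro (⟨p', v', s, h, hs, hτ⟩ | ⟨p', r, S, s, h, hr, hs, hτ⟩)
    · rw [ht] at h
      obtain ⟨rfl, rfl⟩ : p = p' ∧ v = v' := by simpa using h
      exact ⟨s, hs, hτ⟩
    · rw [ht] at h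
      simp at h
  · rintro ⟨s, hs, hτ⟩
    exact .inl ⟨p, v, s, ht, hs, hτ⟩

theorem linPoint_get_iff {p : Fin n} {t τ : ℕ} (ht : E.ev t = some (.inv p .get)) :
    LinPoint E t τ ↔ ∃ r S s, Returns E.ev t r (.vals S) ∧ FirstFull E S s ∧ τ = max s t := by
  constructor
  · rintro (⟨p', v', s, h, hs, hτ⟩ | ⟨p', r, S, s, h, hr, hs, hτ⟩)
    · rw [ht] at h
      simp at h
    · exact ⟨r, S, s, hr, hs, hτ⟩
  · rintro ⟨r, S, s, hr, hs, hτ⟩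
    exact .inr ⟨p, r, S, s, ht, hr, hs, hτ⟩

theorem LinPoint.isOp {t τ : ℕ} (h : LinPoint E t τ) : ∃ p o, E.ev t = some (.inv p o) := by
  rcases h with ⟨p, v, s, h, -⟩ | ⟨p, r, S, s, h, -⟩
  exacts [⟨p, _, h⟩, ⟨p, _, h⟩]

theorem LinPoint.le {t τ : ℕ} (h : LinPoint E t τ) : t ≤ τ := by
  rcases h with ⟨p, v, s, h, hs, rfl⟩ | ⟨p, r, S, s, h, hr, hs, rfl⟩ <;> exact le_max_right _ _

theorem LinPoint.unique {t τ τ' : ℕ} (h : LinPoint E t τ) (h' : LinPoint E t τ') : τ = τ' := by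
  obtain ⟨p, o, ht⟩ := h.isOp
  cases o with
  | add v =>
    obtain ⟨s, hs, rfl⟩ := (linPoint_add_iff ht).1 h
    obtain ⟨s', hs', rfl⟩ := (linPoint_add_iff ht).1 h'
    rw [hs.unique hs']
  | get =>
    obtain ⟨r, S, s, hr, hs, rfl⟩ := (linPoint_get_iff ht).1 h
    obtain ⟨r', S', s', hr', hs', rfl⟩ := (linPoint_get_iff ht).1 h'
    obtain rfl : S = S' := by simpa using (hr.unique hr').2
    rw [hs.unique hs']

/-- A terminated operation has a linearization point, which is at most the time of its response. -/
theorem exists_linPoint_le {t r : ℕ} {y : SetRes V} (hr : Returns E.ev t r y) :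
    ∃ τ, LinPoint E t τ ∧ τ ≤ r := by
  obtain ⟨p, o, ht, htr, -⟩ := id hr
  cases o with
  | add v =>
    obtain ⟨-, u, h1, h2, h3⟩ := E.wsExec.returns_add ht hr
    obtain ⟨s, hs, hs'⟩ := exists_firstFull (E := E) (S := {v}) (u := u)
      fun i => Set.singleton_subset_iff.2 (h3 i)
    exact ⟨_, (linPoint_add_iff ht).2 ⟨s, hs', rfl⟩, max_le (by omega) htr.le⟩
  | get =>
    obtain ⟨S, rfl, u, h1, h2, h3⟩ := E.wsExec.returns_get ht hr
    obtain ⟨s, hs, hs'⟩ := exists_firstFull (E := E) (S := S) (u := u) fun i => (h3 i).ge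
    exact ⟨_, (linPoint_get_iff ht).2 ⟨r, S, s, hr, hs', rfl⟩, max_le (by omega) htr.le⟩

theorem LinPoint.le_of_returns {t τ r : ℕ} {y : SetRes V} (h : LinPoint E t τ)
    (hr : Returns E.ev t r y) : τ ≤ r := by
  obtain ⟨τ', h', hle⟩ := exists_linPoint_le hr
  rwa [h.unique h']

/-- Encodes the lexicographic order on `(τ, b, t)` in one natural number: with `t ≤ τ` and `b ≤ 1`
the lower terms are at most `2 * τ + 1`, less than the gap between consecutive values of `4 * τ ^
2`. -/
theorem lt_of_lex_lt {τ τ' b b' t t' : ℕ} (ht : t ≤ τ) (hb : b ≤ 1) (h : τ < τ') :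
    4 * τ ^ 2 + b * (τ + 1) + t < 4 * τ' ^ 2 + b' * (τ' + 1) + t' := by
  have h1 : b * (τ + 1) ≤ 1 * (τ + 1) := Nat.mul_le_mul_right _ hb
  have h2 : (τ + 1) ^ 2 ≤ τ' ^ 2 := Nat.pow_le_pow_left h 2
  nlinarith

theorem exists_isPointOrder (E : Execution n (weakSet n V) (snapshot n V)) :
    ∃ seq, IsPointOrder E seq := by
  classical
  -- The tie-break at equal points: `0` for `add`, `1` for `get`. The factor `τ + 1` exceeds every
  -- possible `t`, which separates the two kinds; unused codes become gaps of the sequence.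
  let b : ℕ → ℕ := fun t => if ∃ p, E.ev t = some (.inv p .get) then 1 else 0
  have hb : ∀ t, b t ≤ 1 := fun t => by simp only [b]; split_ifs <;> omega
  let pos : ℕ → ℕ → ℕ := fun τ t => 4 * τ ^ 2 + b t * (τ + 1) + t
  have hlt : ∀ τ t τ' t', LinPoint E t τ → LinPoint E t' τ' → pos τ t < pos τ' t' →
      τ < τ' ∨ (τ = τ' ∧ b t ≤ b t') := by
    intro τ t τ' t' h h' hpos
    rcases lt_trichotomy τ τ' with hτ | rfl | hτ
    · exact .inl hτ
    · refine .inr ⟨rfl, ?_⟩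
      by_contra hcon
      have h1 : (b t' + 1) * (τ + 1) ≤ b t * (τ + 1) :=
        Nat.mul_le_mul_right _ (by omega)
      have := h'.le
      simp only [pos] at hpos
      nlinarith
    · have := lt_of_lex_lt (b' := b t) (t' := t) h'.le (hb t') hτ
      exact absurd hpos (not_lt.2 this.le)
  have hinj : ∀ τ t τ' t', LinPoint E t τ → LinPoint E t' τ' → pos τ t = pos τ' t' → t = t' := by
    intro τ t τ' t' h h' hpos
    rcases lt_trichotomy τ τ' with hτ | rfl | hτ
    · exact absurd hpos (lt_of_lex_lt h.le (hb t) hτ).ne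
    · simp only [pos] at hpos
      rcases lt_trichotomy (b t) (b t') with hbb | hbb | hbb
      · have h1 : (b t + 1) * (τ + 1) ≤ b t' * (τ + 1) := Nat.mul_le_mul_right _ (by omega)
        have := h.le
        nlinarith
      · rw [hbb] at hpos; omega
      · have h1 : (b t' + 1) * (τ + 1) ≤ b t * (τ + 1) := Nat.mul_le_mul_right _ (by omega)
        have := h'.le
        nlinarith
    · exact absurd hpos (lt_of_lex_lt h'.le (hb t') hτ).ne'
  let seq : ℕ → Option ℕ := fun k =>
    if h : ∃ t τ, LinPoint E t τ ∧ pos τ t = k then some h.choose else none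
  have hseq : ∀ k t, seq k = some t ↔ ∃ τ, LinPoint E t τ ∧ pos τ t = k := by
    intro k t
    simp only [seq]
    split_ifs with h
    · obtain ⟨τ, hτ, hk⟩ := h.choose_spec
      constructor
      · intro ht
        rw [← Option.some.inj ht]
        exact ⟨τ, hτ, hk⟩
      · rintro ⟨τ', hτ', hk'⟩
        rw [hinj _ _ _ _ hτ hτ' (hk.trans hk'.symm)]
    · constructor
      · intro ht; simp at ht
      · rintro ⟨τ, hτ⟩
        exact absurd ⟨t, τ, hτ⟩ h
  refine ⟨seq, fun t => ?_, ?_, ?_⟩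
  · simp only [hseq]
    exact ⟨fun ⟨k, τ, h, _⟩ => ⟨τ, h⟩, fun ⟨τ, h⟩ => ⟨_, τ, h, rfl⟩⟩
  · intro k l t hk hl
    obtain ⟨τ, hτ, rfl⟩ := (hseq _ _).1 hk
    obtain ⟨τ', hτ', rfl⟩ := (hseq _ _).1 hl
    rw [hτ.unique hτ']
  · intro k l t t' τ τ' hkl hk hl hτ hτ'
    obtain ⟨τ₁, hτ₁, rfl⟩ := (hseq _ _).1 hk
    obtain ⟨τ₂, hτ₂, rfl⟩ := (hseq _ _).1 hl
    obtain rfl := hτ.unique hτ₁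
    obtain rfl := hτ'.unique hτ₂
    refine (hlt _ _ _ _ hτ hτ' hkl).imp_right fun ⟨h1, h2⟩ => ⟨h1, fun hget => ?_⟩
    by_contra hcon
    simp [b, hget, hcon] at h2

/-- Real-time order holds because points lie between invocation and response. The substance is
legality of `get`, where the two inclusions use `subset_added` and `exists_mem_of_le`. -/
theorem IsPointOrder.isLinearization {seq : ℕ → Option ℕ} (h : IsPointOrder E seq) :
    IsLinearization (weakSetSpec V) E.ev seq := by
  have hE := E.wsExec
  refine ⟨?_, h.inj, ?_, ?_, ?_⟩
  · intro k t hk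
    obtain ⟨τ, hτ⟩ := (h.mem_iff t).1 ⟨k, hk⟩
    exact hτ.isOp
  · intro t r y hr
    obtain ⟨τ, hτ, -⟩ := exists_linPoint_le hr
    exact (h.mem_iff t).2 ⟨τ, hτ⟩
  · intro k l t t' r y hk hl hr hlt
    obtain ⟨τ, hτ⟩ := (h.mem_iff t).1 ⟨k, hk⟩
    obtain ⟨τ', hτ'⟩ := (h.mem_iff t').1 ⟨l, hl⟩
    have h1 := hτ.le_of_returns hr
    have h2 := hτ'.le
    by_contra hle
    rcases (not_lt.1 hle).eq_or_lt with rfl | hlk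
    · obtain rfl : t = t' := by simpa [hk] using hl
      obtain ⟨p, o, -, h3, -⟩ := hr
      omega
    · rcases h.sorted l k t' t τ' τ hlk hl hk hτ' hτ with h3 | ⟨h3, -⟩ <;> omega
  · have hadd : ∀ k, (∀ t p v, seq k = some t → E.ev t ≠ some (.inv p (.add v))) →
        {v | ∃ l t p, l < k + 1 ∧ seq l = some t ∧ E.ev t = some (.inv p (.add v))} =
        {v | ∃ l t p, l < k ∧ seq l = some t ∧ E.ev t = some (.inv p (.add v))} := by
      intro k hk
      ext v
      constructor
      · rintro ⟨l, t, p, hl, hlt, ht⟩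
        rcases Nat.lt_succ_iff_lt_or_eq.1 hl with hl | rfl
        · exact ⟨l, t, p, hl, hlt, ht⟩
        · exact absurd ht (hk t p v hlt)
      · rintro ⟨l, t, p, hl, hlt⟩
        exact ⟨l, t, p, by omega, hlt⟩
    -- The abstract state before position `k` is the set of arguments of the `add` operations listed
    -- below `k`.
    refine ⟨fun k => {v | ∃ l t p, l < k ∧ seq l = some t ∧ E.ev t = some (.inv p (.add v))},
      ?_, fun k => ⟨fun hk => hadd k (by simp [hk]), ?_⟩⟩
    · simp only [Nat.not_lt_zero, false_and, exists_false]
      rfl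
    intro t p o hk ht
    cases o with
    | add v =>
      refine ⟨?_, fun r y hr => (hE.returns_add ht hr).1⟩
      refine Set.ext (α := V) fun v' => ?_
      constructor
      · rintro ⟨l, t', p', hl, hlt, ht'⟩
        rcases Nat.lt_succ_iff_lt_or_eq.1 hl with hl | rfl
        · exact .inr ⟨l, t', p', hl, hlt, ht'⟩
        · obtain rfl : t = t' := by simpa [hk] using hlt
          rw [ht] at ht'
          left
          have : p = p' ∧ v = v' := by simpa using ht'
          exact this.2.symm
      · rintro (rfl | ⟨l, t', p', hl, hlt, ht'⟩)
        · exact ⟨k, t, p, by omega, hk, ht⟩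
        · exact ⟨l, t', p', by omega, hlt, ht'⟩
    | get =>
      refine ⟨hadd k fun t' p' v hk' ht' => ?_, fun r y hr => ?_⟩
      · obtain rfl : t = t' := by simpa [hk] using hk'
        rw [ht] at ht'
        simp at ht'
      obtain ⟨S, rfl, u, hu, -, hS⟩ := hE.returns_get ht hr
      obtain ⟨s, hsu, hs⟩ := exists_firstFull (E := E) (S := S) (u := u) fun i => (hS i).ge
      have hτ : LinPoint E t (max s t) := (linPoint_get_iff ht).2 ⟨r, S, s, hr, hs, rfl⟩
      suffices S = {v | ∃ l t p, l < k ∧ seq l = some t ∧ E.ev t = some (.inv p (.add v))} from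
        congrArg SetRes.vals this
      ext v
      constructor
      · intro hv
        obtain ⟨t', p', ht's, ht'⟩ := (hE.subset_added s).1 0 (hs.1 0 hv)
        obtain ⟨s', hs's, hs'⟩ := exists_firstFull (E := E) (S := {v}) (u := s)
          fun i => Set.singleton_subset_iff.2 (hs.1 i hv)
        have hτ' : LinPoint E t' (max s' t') := (linPoint_add_iff ht').2 ⟨s', hs', rfl⟩
        obtain ⟨l, hl⟩ := (h.mem_iff t').2 ⟨_, hτ'⟩
        refine ⟨l, t', p', ?_, hl, ht'⟩
        by_contra hle
        rcases (not_lt.1 hle).eq_or_lt with rfl | hkl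
        · obtain rfl : t = t' := by simpa [hk] using hl
          rw [ht] at ht'
          simp at ht'
        -- The point of this `add` is at most that of the `get`; a tie also puts it first, by the
        -- order at equal points.
        · rcases h.sorted k l t t' _ _ hkl hk hl hτ hτ' with h1 | ⟨-, h2⟩
          · omega
          · obtain ⟨q, hq⟩ := h2 ⟨p, ht⟩
            rw [hq] at ht'
            simp at ht'
      · rintro ⟨l, t', p', hlk, hl, ht'⟩
        obtain ⟨τ', hτ'⟩ := (h.mem_iff t').1 ⟨l, hl⟩
        obtain ⟨s', hs', rfl⟩ := (linPoint_add_iff ht').1 hτ'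
        have hle : max s' t' ≤ max s t := by
          rcases h.sorted l k t' t _ _ hlk hl hk hτ' hτ with h1 | ⟨h1, -⟩ <;> omega
        -- Since `s ≤ u` and `t < u`, the value filled the array by the time `u` of the final scan,
        -- where every component equals `S`.
        obtain ⟨i, hi⟩ := hE.exists_mem_of_le (s := s') (T := u)
          (fun i => hs'.1 i (Set.mem_singleton v)) (by omega)
        rw [← hS i]
        exact hi

theorem weakSet_linearizable : Linearizable n (weakSet n V) (snapshot n V) (weakSetSpec V) := by
  intro E
  obtain ⟨seq, h⟩ := exists_isPointOrder E
  exact ⟨seq, h.isLinearization⟩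

end Points

/-! ### Non-blocking -/

section NonBlocking

open Filter

/-- Without responses, a process that invokes an operation stays running forever, so each of the
finitely many processes invokes at most one more. -/
theorem Execution.eventually_ne_inv {n : ℕ} {Op Res BOp BRes : Type*}
    {A : Algorithm Op Res BOp BRes} {β : SeqSpec BOp BRes} (E : Execution n A β)
    (h : ∀ᶠ t in atTop, ∀ p r, E.ev t ≠ some (.res p r)) :
    ∀ᶠ t in atTop, ∀ p o, E.ev t ≠ some (.inv p o) := by
  obtain ⟨N, hN⟩ := eventually_atTop.1 h
  refine eventually_all.2 fun p => ?_
  by_cases hex : ∃ t o, N ≤ t ∧ E.ev t = some (.inv p o)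
  · obtain ⟨t, o, ht, ho⟩ := hex
    refine eventually_atTop.2 ⟨t + 1, fun t' ht' o' ho' => ?_⟩
    obtain ⟨x, hx⟩ := OpenAt.running (E := E) (p := p) (o := o) (t := t) (T := t')
      ⟨ho, ht', fun s hs _ y => hN s (by omega) p y⟩
    obtain ⟨m, hm⟩ := E.idle_of_inv ho'
    rw [hx] at hm
    simp at hm
  · exact eventually_atTop.2 ⟨N, fun t ht o ho => hex ⟨t, o, ht, ho⟩⟩

variable {n : ℕ} {V : Type*}

/-- The variable `View` of a process. -/
def view : Set V ⊕ WSRun n V → Set V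
  | .inl w => w
  | .inr (.addScan _ _ w) => w
  | .inr (.addUpdate _ _ w) => w
  | .inr (.addReturn w) => w
  | .inr (.getScan _ w) => w
  | .inr (.getUpdate _ w) => w
  | .inr (.getReturn w) => w

/-- The process is about to scan, with the variable `next` equal to `x`. -/
def AtScan (x : Fin n) (s : Set V ⊕ WSRun n V) : Prop :=
  (∃ v w, s = .inr (.addScan v x w)) ∨ ∃ w, s = .inr (.getScan x w)

/-- The process is about to update component `x`. -/
def AtUpdate (x : Fin n) (s : Set V ⊕ WSRun n V) : Prop :=
  (∃ v w, s = .inr (.addUpdate v x w)) ∨ ∃ w, s = .inr (.getUpdate x w)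

/-- The process is about to return. -/
def AtReturn (s : Set V ⊕ WSRun n V) : Prop :=
  (∃ w, s = .inr (.addReturn w)) ∨ ∃ w, s = .inr (.getReturn w)

theorem view_subset_known (s : Set V ⊕ WSRun n V) : view s ⊆ known s := by
  rcases s with w | x
  · exact subset_rfl
  · cases x with
    | addScan v x w => exact Set.subset_insert _ _
    | addUpdate v x w => exact Set.subset_insert _ _
    | _ => exact subset_rfl

theorem view_subset_update {P : Fin n → Set V ⊕ WSRun n V} {p : Fin n} {x : Set V ⊕ WSRun n V}
    (h : view (P p) ⊆ view x) (q : Fin n) : view (P q) ⊆ view (Function.update P p x q) := by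
  by_cases hq : q = p
  · subst hq; simpa using h
  · simp [hq]

variable [NeZero n] {R R' : Fin n → Set V} {P P' : Fin n → Set V ⊕ WSRun n V}
  {e : Option (Event n (SetOp V) (SetRes V))} {p : Fin n}

theorem WSStep.view_subset (h : WSStep R P e R' P') (q : Fin n) : view (P q) ⊆ view (P' q) := by
  cases h with
  | none => exact subset_rfl
  | addScanMore p v x w h hR =>
    exact view_subset_update
      (by rw [h]; exact Set.subset_union_left.trans Set.subset_union_left) q
  | addScanFull p v x w h hR =>
    exact view_subset_update
      (by rw [h]; exact Set.subset_union_left.trans Set.subset_union_left) q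
  | getScanMore p x w h hR =>
    exact view_subset_update (by rw [h]; exact Set.subset_union_left) q
  | getScanFull p x w h hR =>
    exact view_subset_update (by rw [h]; exact Set.subset_union_left) q
  | invAdd p v w h => exact view_subset_update (by rw [h]; exact subset_rfl) q
  | invGet p w h => exact view_subset_update (by rw [h]; exact subset_rfl) q
  | addUpdate p v x w h => exact view_subset_update (by rw [h]; exact subset_rfl) q
  | addReturn p w h => exact view_subset_update (by rw [h]; exact subset_rfl) q
  | getUpdate p x w h => exact view_subset_update (by rw [h]; exact subset_rfl) q
  | getReturn p w h => exact view_subset_update (by rw [h]; exact subset_rfl) q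

theorem WSStep.proc_eq (h : WSStep R P e R' P') (h1 : ∀ o, e ≠ some (.inv p o))
    (h2 : e ≠ some (.int p)) (h3 : ∀ y, e ≠ some (.res p y)) : P' p = P p := by
  cases h <;> first | rfl | exact Function.update_of_ne (by rintro rfl; simp at h1 h2 h3) _ _

/-- Treats `add` and `get` alike: if the test of `add v` continues the loop, some component lacks
`v`, which is in the new view, so here too the components are not all equal to the view. -/
theorem WSStep.int_cases (h : WSStep R P (some (.int p)) R' P') :
    (∃ x, AtScan x (P p) ∧ R' = R ∧ (∀ i, R i ⊆ view (P' p)) ∧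
      ((AtUpdate x (P' p) ∧ ¬ ∀ i, R i = view (P' p)) ∨ AtReturn (P' p))) ∨
    (∃ x, AtUpdate x (P p) ∧ R' = Function.update R x (view (P p)) ∧ AtScan (x + 1) (P' p)) := by
  cases h with
  | addScanMore _ v x w h hR =>
    refine .inl ⟨x, .inl ⟨v, w, h⟩, rfl, fun i => ?_, .inl ?_⟩ <;> rw [Function.update_self]
    · exact (Set.subset_iUnion R i).trans (Set.subset_union_right.trans Set.subset_union_left)
    · refine ⟨.inl ⟨v, _, rfl⟩, fun hall => hR fun i => ?_⟩
      rw [hall i]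
      exact .inr rfl
  | addScanFull _ v x w h hR =>
    refine .inl ⟨x, .inl ⟨v, w, h⟩, rfl, fun i => ?_, .inr ?_⟩ <;> rw [Function.update_self]
    · exact (Set.subset_iUnion R i).trans (Set.subset_union_right.trans Set.subset_union_left)
    · exact .inl ⟨_, rfl⟩
  | addUpdate _ v x w h =>
    refine .inr ⟨x, .inl ⟨v, w, h⟩, by rw [h]; rfl, ?_⟩
    rw [Function.update_self]
    exact .inl ⟨v, w, rfl⟩
  | getScanMore _ x w h hR =>
    refine .inl ⟨x, .inr ⟨w, h⟩, rfl, fun i => ?_, .inl ?_⟩ <;> rw [Function.update_self]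
    · exact (Set.subset_iUnion R i).trans Set.subset_union_right
    · exact ⟨.inr ⟨_, rfl⟩, hR⟩
  | getScanFull _ x w h hR =>
    refine .inl ⟨x, .inr ⟨w, h⟩, rfl, fun i => ?_, .inr ?_⟩ <;> rw [Function.update_self]
    · exact (Set.subset_iUnion R i).trans Set.subset_union_right
    · exact .inr ⟨_, rfl⟩
  | getUpdate _ x w h =>
    refine .inr ⟨x, .inr ⟨w, h⟩, by rw [h]; rfl, ?_⟩
    rw [Function.update_self]
    exact .inr ⟨w, rfl⟩

theorem WSStep.not_atReturn (h : WSStep R P (some (.int p)) R' P') : ¬ AtReturn (P p) := by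
  rintro (⟨w, hw⟩ | ⟨w, hw⟩) <;>
  rcases h.int_cases with ⟨x, ⟨_, _, hx⟩ | ⟨_, hx⟩, -⟩ | ⟨x, ⟨_, _, hx⟩ | ⟨_, hx⟩, -⟩ <;>
  simp [hw] at hx

omit [NeZero n] in
theorem AtUpdate.not_atScan {x y : Fin n} {s : Set V ⊕ WSRun n V} (h : AtUpdate x s) :
    ¬ AtScan y s := by
  rintro (⟨_, _, hx⟩ | ⟨_, hx⟩) <;> rcases h with ⟨_, _, h⟩ | ⟨_, h⟩ <;> simp [hx] at h

omit [NeZero n] in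
theorem AtUpdate.unique {x y : Fin n} {s : Set V ⊕ WSRun n V} (h : AtUpdate x s)
    (h' : AtUpdate y s) : x = y := by
  rcases h with ⟨_, _, h⟩ | ⟨_, h⟩ <;> rcases h' with ⟨_, _, h'⟩ | ⟨_, h'⟩ <;> simp [h] at h' <;>
  first | exact h'.2.1 | exact h'.1

omit [NeZero n] in
theorem finite_added (ev : ℕ → Option (Event n (SetOp V) (SetRes V))) (T : ℕ) :
    (added ev T).Finite := by
  refine ((Set.finite_Iio T).biUnion (t := fun t => {v | ∃ p, ev t = some (.inv p (.add v))})
    fun t _ => Set.Subsingleton.finite ?_).subset ?_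
  · rintro v ⟨p, hp⟩ v' ⟨p', hp'⟩
    rw [hp] at hp'
    have : p = p' ∧ v = v' := by simpa using hp'
    exact this.2
  · rintro v ⟨t, p, ht, hv⟩
    exact Set.mem_biUnion (x := t) ht ⟨p, hv⟩

/-- The union is finite, and each of its elements is present from some time on. -/
theorem eventually_eq_iUnion {α : Type*} {f : ℕ → Set α} (hf : Monotone f) {F : Set α}
    (hF : F.Finite) (hfF : ∀ t, f t ⊆ F) : ∀ᶠ t in atTop, f t = ⋃ s, f s := by
  have hfin : (⋃ s, f s).Finite := hF.subset (Set.iUnion_subset hfF)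
  have : ∀ᶠ t in atTop, ∀ v ∈ ⋃ s, f s, v ∈ f t := by
    refine (eventually_all_finite hfin).2 fun v hv => ?_
    obtain ⟨s, hs⟩ := Set.mem_iUnion.1 hv
    exact eventually_atTop.2 ⟨s, fun t ht => hf ht hs⟩
  exact this.mono fun t ht => (Set.subset_iUnion f t).antisymm ht

/-! ### Processes that take infinitely many steps in a nonterminating execution -/

section

variable {R : ℕ → Fin n → Set V} {P : ℕ → Fin n → Set V ⊕ WSRun n V}
  {ev : ℕ → Option (Event n (SetOp V) (SetRes V))} {T : ℕ} {p : Fin n}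

/-- A process that takes infinitely many steps, from a time after which no operation is invoked or
terminates, eventually takes its next step. -/
theorem WSExec.exists_next_step (h : WSExec R P ev)
    (hT : ∀ t, T ≤ t → ∀ p r, ev t ≠ some (.res p r))
    (hT' : ∀ t, T ≤ t → ∀ p o, ev t ≠ some (.inv p o)) (hp : ∃ᶠ t in atTop, ev t = some (.int p))
    {t : ℕ} (ht : T ≤ t) : ∃ t', t ≤ t' ∧ ev t' = some (.int p) ∧ P t' p = P t p := by
  classical
  have hex : ∃ d, ev (t + d) = some (.int p) := by
    obtain ⟨t', h1, h2⟩ := frequently_atTop.1 hp t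
    exact ⟨t' - t, by rwa [Nat.add_sub_cancel' h1]⟩
  have hsame : ∀ d, d ≤ Nat.find hex → P (t + d) p = P t p := by
    intro d
    induction d with
    | zero => intro; rfl
    | succ d ih =>
      intro hd
      rw [← ih (by omega)]
      exact (h.step (t + d)).proc_eq (hT' _ (by omega) p) (Nat.find_min hex (by omega))
        (hT _ (by omega) p)
  exact ⟨_, by omega, Nat.find_spec hex, hsame _ le_rfl⟩

/-- The next step of such a process would be a response. -/
theorem WSExec.not_atReturn (h : WSExec R P ev)
    (hT : ∀ t, T ≤ t → ∀ p r, ev t ≠ some (.res p r))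
    (hT' : ∀ t, T ≤ t → ∀ p o, ev t ≠ some (.inv p o)) (hp : ∃ᶠ t in atTop, ev t = some (.int p))
    {t : ℕ} (ht : T ≤ t) : ¬ AtReturn (P t p) := by
  obtain ⟨t', -, h2, h3⟩ := h.exists_next_step hT hT' hp ht
  rw [← h3]
  have := h.step t'
  rw [h2] at this
  exact this.not_atReturn

/-- Such a process makes a scan after every time. -/
theorem WSExec.exists_scan (h : WSExec R P ev)
    (hT : ∀ t, T ≤ t → ∀ p r, ev t ≠ some (.res p r))
    (hT' : ∀ t, T ≤ t → ∀ p o, ev t ≠ some (.inv p o)) (hp : ∃ᶠ t in atTop, ev t = some (.int p))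
    {t : ℕ} (ht : T ≤ t) :
    ∃ t' x, t ≤ t' ∧ R (t' + 1) = R t' ∧ (∀ i, R t' i ⊆ view (P (t' + 1) p)) ∧
      AtUpdate x (P (t' + 1) p) ∧ ¬ ∀ i, R t' i = view (P (t' + 1) p) := by
  have key : ∀ t' x, t ≤ t' → ev t' = some (.int p) → AtScan x (P t' p) →
      ∃ t' x, t ≤ t' ∧ R (t' + 1) = R t' ∧ (∀ i, R t' i ⊆ view (P (t' + 1) p)) ∧
        AtUpdate x (P (t' + 1) p) ∧ ¬ ∀ i, R t' i = view (P (t' + 1) p) := by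
    intro t' x h1 h2 h3
    have hs := h.step t'
    rw [h2] at hs
    rcases hs.int_cases with ⟨y, -, h5, h6, h7⟩ | ⟨y, h4, -⟩
    · exact ⟨t', y, h1, h5, h6,
        h7.resolve_right (h.not_atReturn hT hT' hp (ht.trans (h1.trans (Nat.le_succ _))))⟩
    · exact absurd h3 h4.not_atScan
  obtain ⟨t', h1, h2, -⟩ := h.exists_next_step hT hT' hp ht
  have hs := h.step t'
  rw [h2] at hs
  rcases hs.int_cases with ⟨y, h4, -⟩ | ⟨y, -, -, h6⟩
  · exact key t' y h1 h2 h4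
  · obtain ⟨t'', h1', h2', h3'⟩ := h.exists_next_step hT hT' hp (t := t' + 1) (by omega)
    exact key t'' (y + 1) (by omega) h2' (h3' ▸ h6)

/-- Such a process updates all components. -/
theorem WSExec.exists_update (h : WSExec R P ev)
    (hT : ∀ t, T ≤ t → ∀ p r, ev t ≠ some (.res p r))
    (hT' : ∀ t, T ≤ t → ∀ p o, ev t ≠ some (.inv p o)) (hp : ∃ᶠ t in atTop, ev t = some (.int p))
    (i : Fin n) : ∃ t, T ≤ t ∧ R (t + 1) i = view (P t p) := by
  have hupd : ∀ t x, T ≤ t → AtUpdate x (P t p) → ∃ t', T ≤ t' ∧ R (t' + 1) x = view (P t' p) ∧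
      AtScan (x + 1) (P (t' + 1) p) := by
    intro t x ht hx
    obtain ⟨t', h1, h2, h3⟩ := h.exists_next_step hT hT' hp ht
    have hs := h.step t'
    rw [h2] at hs
    rw [← h3] at hx
    rcases hs.int_cases with ⟨y, h4, -⟩ | ⟨y, h4, h5, h6⟩
    · exact absurd h4 hx.not_atScan
    · obtain rfl := hx.unique h4
      exact ⟨t', ht.trans h1, by rw [h5, Function.update_self], h6⟩
  obtain ⟨t₀, x, h1, -, -, h2, -⟩ := h.exists_scan hT hT' hp le_rfl
  -- From one pending update of component `x`, the loop visits `x`, `x + 1`, … modulo `n`; taking `k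
  -- = (i - x).val` reaches component `i`.
  have hall : ∀ k : ℕ, ∃ t, T ≤ t ∧ AtUpdate (x + Fin.ofNat n k) (P t p) := by
    intro k
    induction k with
    | zero => exact ⟨_, h1.trans (Nat.le_succ _), by simpa using h2⟩
    | succ k ih =>
      obtain ⟨t, ht, hx⟩ := ih
      obtain ⟨t', ht', -, hx'⟩ := hupd t _ ht hx
      obtain ⟨t'', h1'', h2'', h3''⟩ := h.exists_next_step hT hT' hp (t := t' + 1) (by omega)
      have hs := h.step t''
      rw [h2''] at hs
      rw [← h3''] at hx'
      have hk : x + Fin.ofNat n (k + 1) = x + Fin.ofNat n k + 1 := by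
        rw [add_assoc]; congr 1; ext; simp [Fin.val_add]
      rcases hs.int_cases with ⟨y, h4, -, -, h7⟩ | ⟨y, h4, -⟩
      · have hy : y = x + Fin.ofNat n k + 1 := by
          rcases h4 with ⟨_, _, h4⟩ | ⟨_, h4⟩ <;> rcases hx' with ⟨_, _, hx'⟩ | ⟨_, hx'⟩ <;>
            rw [hx'] at h4 <;> cases h4 <;> rfl
        refine ⟨t'' + 1, by omega, ?_⟩
        rw [hk, ← hy]
        exact (h7.resolve_right (h.not_atReturn hT hT' hp (by omega))).1
      · exact absurd hx' h4.not_atScan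
  obtain ⟨t, ht, hx⟩ := hall (i - x).val
  rw [show x + Fin.ofNat n (i - x).val = i by simp] at hx
  obtain ⟨t', ht', h', -⟩ := hupd t i ht hx
  exact ⟨t', ht', h'⟩

theorem WSExec.false_of_nonterminating (h : WSExec R P ev)
    (hf : ∃ᶠ t in atTop, ev t ≠ none)
    (h1 : ∀ᶠ t in atTop, ∀ p r, ev t ≠ some (.res p r))
    (h2 : ∀ᶠ t in atTop, ∀ p o, ev t ≠ some (.inv p o)) : False := by
  -- `S` consists of the processes that move forever, and `Ω p` is the limit of the growing view of
  -- `p`.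
  let S : Set (Fin n) := {p | ∃ᶠ t in atTop, ev t = some (.int p)}
  let Ω : Fin n → Set V := fun p => ⋃ t, view (P t p)
  have hview : ∀ᶠ t in atTop, ∀ p, view (P t p) = Ω p := by
    refine eventually_all.2 fun p => ?_
    obtain ⟨N, hN⟩ := eventually_atTop.1 h2
    refine eventually_eq_iUnion (monotone_nat_of_le_succ fun t => (h.step t).view_subset p)
      (finite_added ev N) fun t v hv => ?_
    obtain ⟨s, q, -, hq⟩ := (h.subset_added t).2 p (view_subset_known _ hv)
    refine ⟨s, q, ?_, hq⟩
    by_contra hs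
    exact hN s (not_lt.1 hs) _ _ hq
  have hS : ∀ᶠ t in atTop, ∀ p, ev t = some (.int p) → p ∈ S := by
    refine eventually_all.2 fun p => ?_
    by_cases hp : p ∈ S
    · exact .of_forall fun t _ => hp
    · exact (not_frequently.1 hp).mono fun t ht h => absurd h ht
  obtain ⟨T, hall⟩ := eventually_atTop.1 (h1.and (h2.and (hview.and hS)))
  have hres := fun t ht => (hall t ht).1
  have hinv := fun t ht => (hall t ht).2.1
  have hev : ∀ t, T ≤ t → ev t = none ∨ ∃ p ∈ S, ev t = some (.int p) := by
    intro t ht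
    match hevt : ev t with
    | none => exact .inl rfl
    | some (.inv p o) => exact absurd hevt (hinv t ht p o)
    | some (.res p r) => exact absurd hevt (hres t ht p r)
    | some (.int p) => exact .inr ⟨p, (hall t ht).2.2.2 p hevt, rfl⟩
  have hne : S.Nonempty := by
    obtain ⟨t, ht, ht'⟩ := frequently_atTop.1 hf T
    obtain ⟨p, hp, -⟩ := (hev t ht).resolve_left ht'
    exact ⟨p, hp⟩
  -- eventually all components hold stable views
  have hpersist : ∀ i t, T ≤ t → (∃ q ∈ S, R t i = Ω q) → ∃ q ∈ S, R (t + 1) i = Ω q := by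
    intro i t ht hq
    have hs := h.step t
    rcases hev t ht with he | ⟨p, hp, he⟩
    · rw [he] at hs
      generalize R (t + 1) = R', P (t + 1) = P' at hs ⊢
      cases hs
      exact hq
    · rw [he] at hs
      rcases hs.int_cases with ⟨x, -, hR, -⟩ | ⟨x, -, hR, -⟩
      · rwa [hR]
      · rw [hR]
        by_cases hi : i = x
        · subst hi
          exact ⟨p, hp, by rw [Function.update_self, (hall t ht).2.2.1]⟩
        · rwa [Function.update_of_ne hi]
  have hR : ∀ᶠ t in atTop, ∀ i, ∃ q ∈ S, R t i = Ω q := by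
    refine eventually_all.2 fun i => ?_
    obtain ⟨p, hp⟩ := hne
    obtain ⟨t, ht, hti⟩ := h.exists_update hres hinv hp i
    refine eventually_atTop.2 ⟨t + 1, fun t' ht' => ?_⟩
    induction t', ht' using Nat.le_induction with
    | base => exact ⟨p, hp, by rw [hti, (hall t ht).2.2.1]⟩
    | succ t' ht' ih => exact hpersist i t' (by omega) ih
  obtain ⟨T', hT'⟩ := eventually_atTop.1 hR
  -- Each component is some `Ω p`, and a scan by `q` shows `Ω p ⊆ Ω q`; minimality turns this into
  -- equality, contradicting that `q` continues its loop.
  obtain ⟨q, hq, hmin⟩ := Set.Finite.exists_minimalFor Ω S S.toFinite hne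
  obtain ⟨t, x, ht, -, hsub, -, hnot⟩ := h.exists_scan hres hinv hq (le_max_left T T')
  rw [(hall (t + 1) (by omega)).2.2.1] at hsub hnot
  refine hnot fun i => ?_
  obtain ⟨p, hp, hpi⟩ := hT' t (by omega) i
  have := hsub i
  rw [hpi] at this ⊢
  exact this.antisymm (hmin hp this)

end

theorem weakSet_nonBlocking : NonBlocking n (weakSet n V) (snapshot n V) := by
  intro E hE
  by_contra hcon
  have h1 : ∀ᶠ t in atTop, ∀ p r, E.ev t ≠ some (.res p r) :=
    (not_frequently.1 hcon).mono fun t ht p r h => ht ⟨p, r, h⟩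
  exact E.wsExec.false_of_nonterminating hE h1 (E.eventually_ne_inv h1)

end NonBlocking

end AnonShm

open AnonShm in
theorem mainTheorem5 (n : ℕ) [NeZero n] (V : Type*) :
    (∀ E : Execution n (weakSet n V) (snapshot n V),
      (∀ t τ, LinPoint E t τ → t ≤ τ ∧ ∀ r y, Returns E.ev t r y → τ ≤ r) ∧
      (∀ t r y, Returns E.ev t r y → ∃ τ, LinPoint E t τ) ∧
      (∃ seq, IsPointOrder E seq) ∧
      (∀ seq, IsPointOrder E seq → IsLinearization (weakSetSpec V) E.ev seq)) ∧
    NonBlocking n (weakSet n V) (snapshot n V) ∧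
    (∀ (W : Type*) (w₀ : W) (I : Algorithm (SnapOp n V) (SnapRes n V) (RegOp n W) (RegRes W)),
      Linearizable n I (registers n w₀) (snapshot n V) →
      NonBlocking n I (registers n w₀) →
      Linearizable n ((weakSet n V).comp I) (registers n w₀) (weakSetSpec V) ∧
      NonBlocking n ((weakSet n V).comp I) (registers n w₀)) := by
  refine ⟨fun E => ⟨fun t τ h => ⟨h.le, fun r y => h.le_of_returns⟩, fun t r y hr => ?_,
    exists_isPointOrder E, fun seq h => h.isLinearization⟩, weakSet_nonBlocking, ?_⟩
  · obtain ⟨τ, h, -⟩ := exists_linPoint_le hr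
    exact ⟨τ, h⟩
  · intro W w₀ I hlin hnb
    exact ⟨weakSet_linearizable.comp hlin hnb, weakSet_nonBlocking.comp hlin hnb⟩
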